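/- Let $n>0$ and let $Y$ be observed from the white noise model $dY(t)=f(t)\,dt+n^{-1/2}\,dW(t)$, $-\frac12\le t\le\frac12$, where $W$ is a standard Brownian motion. Write $z_\alpha=\Phi^{-1}(1-\alpha)$, where $\Phi$ is the standard normal distribution function, and for integers $j\ge 2$ put $\sigma_j=\sqrt{2^{j-1}/n}$, $$\delta_j^R=2^j\bigl(Y(2^{-j})-Y(0)\bigr),\qquad \delta_j^L=2^j\bigl(Y(0)-Y(-2^{-j})\bigr),$$ $$\xi_j=2^{j-1}\bigl(Y(2^{-j+1})-Y(2^{-j})\bigr)-2^{j-1}\bigl(Y(-2^{-j})-Y(-2^{-j+1})\bigr),$$ $$\mathrm{CI}_j^m(\alpha)=\bigl[\delta_j^L-z_{\alpha/2}\sqrt2\,\sigma_j,\ \delta_j^R+z_{\alpha/2}\sqrt2\,\sigma_j\bigr],$$ where the interval is empty, and has length $0$, if its left endpoint exceeds its right endpoint. Let $\hat j=\inf\{j\ge2:\xi_j\le\frac32 z_\alpha\sigma_j\}$, $\mathrm{CI}_*^m=\mathrm{CI}_{\hat j}^m(\alpha)$, and $j_*^m=\min\{j\ge2:E_f\,\xi_j\le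 z_\alpha\sigma_j\}$, and write $L(\mathrm{CI}_*^m)$ for the length of $\mathrm{CI}_*^m$. Theorem. Let $0<\alpha\le0.2$. For every nondecreasing function $f$ on $[-\frac12,\frac12]$, the scale $\hat j$ is almost surely finite, $j_*^m$ exists, $P_f\bigl(f(0)\in\mathrm{CI}_*^m\bigr)\ge1-\alpha$, and $$E_f L(\mathrm{CI}_*^m)\le1.21\,\bigl(3z_\alpha+2\sqrt2\,z_{\alpha/2}\bigr)\sigma_{j_*^m}\le8.85\,z_\alpha\,\sigma_{j_*^m}.$$ -/

import Mathlib

open MeasureTheory ProbabilityTheory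

namespace MonotoneCI

noncomputable section

/-- Upper normal quantile `z_α = Φ⁻¹(1 - α)`, where `Φ` is the standard normal distribution
function. As `Φ` is continuous and strictly increasing, for `0 < α < 1` this infimum is the
unique `x` with `Φ x = 1 - α`. -/
def zQuantile (α : ℝ) : ℝ :=
  sInf {x : ℝ | 1 - α ≤ cdf (gaussianReal 0 1) x}

variable {Ω : Type*} [MeasurableSpace Ω]

/-- Under `P`, the process `Y` (of which only the values on `[-1/2, 1/2]` matter) is an
observation from the white noise model `dY(t) = f(t) dt + n^{-1/2} dW(t)`, `-1/2 ≤ t ≤ 1/2`.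
The standard Brownian motion is started at the left end of the interval; a Brownian motion
normalised elsewhere has the same increments. The value `Y (-1/2)` is left free. -/
def IsWhiteNoiseObservation (f : ℝ → ℝ) (n : ℝ) (Y : ℝ → Ω → ℝ) (P : Measure Ω) : Prop :=
  ∃ W : NNReal → Ω → ℝ, IsBrownianReal W P ∧
    ∀ᵐ ω ∂P, ∀ t ∈ Set.Icc (-(1 / 2) : ℝ) (1 / 2),
      Y t ω - Y (-(1 / 2)) ω =
        (∫ u in (-(1 / 2) : ℝ)..t, f u) + n ^ (-(1 / 2) : ℝ) * W (Real.toNNReal (t + 1 / 2)) ω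

/-- `σ_j`, with `σ_j² = 2^{j-1} / n`. -/
def sigma (n : ℝ) (j : ℕ) : ℝ :=
  √((2 : ℝ) ^ ((j : ℤ) - 1) / n)

/-- `δ_j^R = 2^j (Y(2^{-j}) - Y(0))`. -/
def deltaR (Y : ℝ → Ω → ℝ) (j : ℕ) (ω : Ω) : ℝ :=
  (2 : ℝ) ^ j * (Y ((2 : ℝ) ^ (-(j : ℤ))) ω - Y 0 ω)

/-- `δ_j^L = 2^j (Y(0) - Y(-2^{-j}))`. -/
def deltaL (Y : ℝ → Ω → ℝ) (j : ℕ) (ω : Ω) : ℝ :=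
  (2 : ℝ) ^ j * (Y 0 ω - Y (-(2 : ℝ) ^ (-(j : ℤ))) ω)

/-- `ξ_j = 2^{j-1} (Y(2^{-j+1}) - Y(2^{-j})) - 2^{j-1} (Y(-2^{-j}) - Y(-2^{-j+1}))`. -/
def xi (Y : ℝ → Ω → ℝ) (j : ℕ) (ω : Ω) : ℝ :=
  (2 : ℝ) ^ ((j : ℤ) - 1) * (Y ((2 : ℝ) ^ (-(j : ℤ) + 1)) ω - Y ((2 : ℝ) ^ (-(j : ℤ))) ω)
    - (2 : ℝ) ^ ((j : ℤ) - 1) *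
      (Y (-(2 : ℝ) ^ (-(j : ℤ))) ω - Y (-(2 : ℝ) ^ (-(j : ℤ) + 1)) ω)

/-- Left endpoint of `CI_j^m(α)`. -/
def ciLeft (n α : ℝ) (Y : ℝ → Ω → ℝ) (j : ℕ) (ω : Ω) : ℝ :=
  deltaL Y j ω - zQuantile (α / 2) * √2 * sigma n j

/-- Right endpoint of `CI_j^m(α)`. -/
def ciRight (n α : ℝ) (Y : ℝ → Ω → ℝ) (j : ℕ) (ω : Ω) : ℝ :=
  deltaR Y j ω + zQuantile (α / 2) * √2 * sigma n j

/-- The interval `CI_j^m(α)`; it is empty if its left endpoint exceeds its right endpoint. -/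
def ci (n α : ℝ) (Y : ℝ → Ω → ℝ) (j : ℕ) (ω : Ω) : Set ℝ :=
  Set.Icc (ciLeft n α Y j ω) (ciRight n α Y j ω)

/-- The length of `CI_j^m(α)`, which is `0` when the interval is empty. -/
def ciLength (n α : ℝ) (Y : ℝ → Ω → ℝ) (j : ℕ) (ω : Ω) : ℝ :=
  max (ciRight n α Y j ω - ciLeft n α Y j ω) 0

/-- The scales `j ≥ 2` with `ξ_j ≤ (3/2) z_α σ_j`. -/
def acceptedScales (n α : ℝ) (Y : ℝ → Ω → ℝ) (ω : Ω) : Set ℕ :=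
  {j : ℕ | 2 ≤ j ∧ xi Y j ω ≤ 3 / 2 * zQuantile α * sigma n j}

/-- The data-driven scale `ĵ`, the least accepted scale. -/
def jHat (n α : ℝ) (Y : ℝ → Ω → ℝ) (ω : Ω) : ℕ :=
  sInf (acceptedScales n α Y ω)

/-- The confidence interval `CI_*^m = CI_ĵ^m(α)`. -/
def ciStar (n α : ℝ) (Y : ℝ → Ω → ℝ) (ω : Ω) : Set ℝ :=
  ci n α Y (jHat n α Y ω) ω

/-- The length `L(CI_*^m)`. -/
def ciStarLength (n α : ℝ) (Y : ℝ → Ω → ℝ) (ω : Ω) : ℝ :=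
  ciLength n α Y (jHat n α Y ω) ω

/-- The scales `j ≥ 2` with `E ξ_j ≤ z_α σ_j`. -/
def targetScales (n α : ℝ) (Y : ℝ → Ω → ℝ) (P : Measure Ω) : Set ℕ :=
  {j : ℕ | 2 ≤ j ∧ ∫ ω, xi Y j ω ∂P ≤ zQuantile α * sigma n j}

/-- The deterministic scale `j_*^m`, the least target scale. -/
def jStar (n α : ℝ) (Y : ℝ → Ω → ℝ) (P : Measure Ω) : ℕ :=
  sInf (targetScales n α Y P)

end

end MonotoneCI

/-! The argument rests on where the increments live. With `dyadic j` = 2⁻ʲ, `xi` at scale i uses the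
increments of `Y` over ±[2⁻ⁱ, 2·2⁻ⁱ], while `deltaL` and `deltaR` at scale j use those over ±[0,
2⁻ʲ]. Hence the `xi` are independent across scales (`indepFun_xi`), and whether j is the first
accepted scale is independent of the interval at scale j (`indepFun_xi_delta`). Selection costs
nothing: both coverage and expected length split into sums over j of P(ĵ = j) times a fixed-scale
quantity.

Coverage at a fixed scale follows from `driftL_le` and `le_driftR`: monotonicity biases the
endpoints outwards, so each side fails with probability at most α/2.

For the length, put z = z_α, K = 2√2 z_{α/2}, m = j_*^m and D_j = `driftR f j - driftL f j`. A fixed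
interval has mean length at most D_j + (K + 1/K)σ_j (`integral_ciLength_le`). Monotonicity of f
gives D_j ≤ 2 E ξ_{j+1} and makes E ξ_j nonincreasing in j, so D_j ≤ 2zσ_m once j ≥ m - 1. From
scale m on, each rejection has probability at most 0.35. As 0.35·√2 < 1, the growth of σ_j is
summable against the survival probabilities (`sum_geometric_le`), and ĵ is almost surely finite. For
j ≤ m - 2, D_j may be large, but then E ξ_j is far above the acceptance threshold, and Chebyshev's
inequality bounds P(ĵ = j)(D_j - 3zσ_m) (`real_firstAccept_mul_le`). `sum_length_le` combines the
two regimes.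

The constants 1.21 and 8.85 need z ≥ 0.841 and z_{α/2} ≤ 1.5252 z, which come from Taylor bounds for
Φ and the tail comparison `cdf_gaussian_mul_ge`. -/

namespace MonotoneCI

/-! ### The standard normal distribution function -/

theorem cdf_gaussian_sub (a b : ℝ) :
    cdf (gaussianReal 0 1) b - cdf (gaussianReal 0 1) a = ∫ x in a..b, gaussianPDFReal 0 1 x := by
  have h : ∀ x, cdf (gaussianReal 0 1) x = ∫ u in Set.Iic x, gaussianPDFReal 0 1 u := by
    intro x
    rw [cdf_eq_real, measureReal_def, gaussianReal_apply_eq_integral 0 one_ne_zero,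
      ENNReal.toReal_ofReal]
    exact integral_nonneg fun u => gaussianPDFReal_nonneg 0 1 u
  rw [h, h, intervalIntegral.integral_Iic_sub_Iic] <;>
  exact (integrable_gaussianPDFReal 0 1).integrableOn

theorem gaussianPDFReal_std (x : ℝ) :
    gaussianPDFReal 0 1 x = (√(2 * Real.pi))⁻¹ * Real.exp (-(x ^ 2 / 2)) := by
  simp [gaussianPDFReal, neg_div]

theorem continuous_gaussianPDFReal_std : Continuous (gaussianPDFReal 0 1) := by
  have : gaussianPDFReal 0 1 = fun x => (√(2 * Real.pi))⁻¹ * Real.exp (-(x ^ 2 / 2)) :=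
    funext gaussianPDFReal_std
  rw [this]
  fun_prop

theorem hasDerivAt_cdf_gaussian (x : ℝ) :
    HasDerivAt (fun y => cdf (gaussianReal 0 1) y) (gaussianPDFReal 0 1 x) x := by
  have h : (fun y => cdf (gaussianReal 0 1) y)
      = fun y => cdf (gaussianReal 0 1) 0 + ∫ u in (0 : ℝ)..y, gaussianPDFReal 0 1 u := by
    funext y
    rw [← cdf_gaussian_sub]
    ring
  rw [h]
  exact (intervalIntegral.integral_hasDerivAt_right
    (continuous_gaussianPDFReal_std.intervalIntegrable _ _)
    (continuous_gaussianPDFReal_std.stronglyMeasurableAtFilter _ _)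
    continuous_gaussianPDFReal_std.continuousAt).const_add _

theorem continuous_cdf_gaussian : Continuous (fun y => cdf (gaussianReal 0 1) y) :=
  continuous_iff_continuousAt.2 fun x => (hasDerivAt_cdf_gaussian x).continuousAt

theorem gaussian_Ioi (x : ℝ) :
    (gaussianReal 0 1).real (Set.Ioi x) = 1 - cdf (gaussianReal 0 1) x := by
  rw [cdf_eq_real, ← Set.compl_Iic, measureReal_compl measurableSet_Iic]
  simp

theorem gaussian_Iio_neg (x : ℝ) :
    (gaussianReal 0 1).real (Set.Iio (-x)) = 1 - cdf (gaussianReal 0 1) x := by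
  rw [← gaussian_Ioi]
  have h := gaussianReal_map_neg (μ := 0) (v := 1)
  rw [neg_zero] at h
  conv_lhs => rw [← h]
  rw [map_measureReal_apply (by fun_prop) measurableSet_Iio]
  congr 1
  ext y
  simp

theorem cdf_gaussian_zero : cdf (gaussianReal 0 1) 0 = 1 / 2 := by
  have h1 := gaussian_Iio_neg 0
  have : NullSingletonClass (gaussianReal 0 1) := nullSingletonClass_gaussianReal one_ne_zero
  have h2 : (gaussianReal 0 1).real (Set.Iio (-0)) = (gaussianReal 0 1).real (Set.Iic 0) := by
    rw [neg_zero]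
    exact measureReal_congr Iio_ae_eq_Iic
  rw [h2, ← cdf_eq_real] at h1
  linarith

/-! ### Quantiles -/

theorem bddBelow_cdf_superlevel {p : ℝ} (hp : 0 < p) :
    BddBelow {x : ℝ | p ≤ cdf (gaussianReal 0 1) x} := by
  obtain ⟨b, hb⟩ := ((tendsto_cdf_atBot (gaussianReal 0 1)).eventually (gt_mem_nhds hp)).exists
  refine ⟨b, fun x hx => ?_⟩
  by_contra! h
  exact absurd (hx.trans (monotone_cdf _ h.le)) (not_le.2 hb)

/-- Continuity of Φ makes the superlevel set closed, so its infimum is attained. This and minimality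
(`zQuantile_le`) are all that is used about the quantile. -/
theorem le_cdf_zQuantile {α : ℝ} (h0 : 0 < α) (h1 : α < 1) :
    1 - α ≤ cdf (gaussianReal 0 1) (zQuantile α) := by
  refine IsClosed.csInf_mem (s := {x : ℝ | 1 - α ≤ cdf (gaussianReal 0 1) x}) ?_ ?_
    (bddBelow_cdf_superlevel (by linarith))
  · exact isClosed_le continuous_const continuous_cdf_gaussian
  · obtain ⟨b, hb⟩ := ((tendsto_cdf_atTop (gaussianReal 0 1)).eventually
      (lt_mem_nhds (by linarith : 1 - α < 1))).exists
    exact ⟨b, hb.le⟩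

theorem zQuantile_le {α x : ℝ} (h1 : α < 1) (hx : 1 - α ≤ cdf (gaussianReal 0 1) x) :
    zQuantile α ≤ x :=
  csInf_le (bddBelow_cdf_superlevel (by linarith)) hx

theorem zQuantile_le_half {α : ℝ} (h0 : 0 < α) (h1 : α < 1) :
    zQuantile α ≤ zQuantile (α / 2) :=
  zQuantile_le h1 (by linarith [le_cdf_zQuantile (α := α / 2) (by linarith) (by linarith)])

/-! ### Numerical bounds -/

/-- The Taylor polynomial of degree `6` of `exp (-u)` at `u = t ^ 2 / 2`. -/
noncomputable def expTaylor (t : ℝ) : ℝ :=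
  1 - t ^ 2 / 2 + t ^ 4 / 8 - t ^ 6 / 48 + t ^ 8 / 384 - t ^ 10 / 3840 + t ^ 12 / 46080

/-- The remainder in `Real.exp_bound` with n = 7 is (t²/2)⁷ · 8/(7!·7), valid for t²/2 ≤ 1. -/
theorem abs_exp_sub_expTaylor {t : ℝ} (ht : t ^ 2 ≤ 2) :
    |Real.exp (-(t ^ 2 / 2)) - expTaylor t| ≤ t ^ 14 / 564480 := by
  have h := Real.exp_bound (x := -(t ^ 2 / 2)) (by
    rw [abs_neg, abs_of_nonneg (by positivity)]; linarith) (n := 7) (by norm_num)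
  rw [abs_neg, abs_of_nonneg (by positivity : 0 ≤ t ^ 2 / 2)] at h
  have e1 : ∑ m ∈ Finset.range 7, (-(t ^ 2 / 2)) ^ m / (m.factorial : ℝ) = expTaylor t := by
    simp [Finset.sum_range_succ, Nat.factorial, expTaylor]
    ring
  rw [e1] at h
  refine h.trans (le_of_eq ?_)
  simp [Nat.factorial]
  ring

theorem abs_integral_exp_sub_le {x : ℝ} (hx : 0 ≤ x) (hx2 : x ^ 2 ≤ 2) :
    |(∫ t in (0 : ℝ)..x, Real.exp (-(t ^ 2 / 2))) - (x - x ^ 3 / 6 + x ^ 5 / 40 - x ^ 7 / 336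
      + x ^ 9 / 3456 - x ^ 11 / 42240 + x ^ 13 / 599040)| ≤ x ^ 15 / 8467200 := by
  have hT : Continuous expTaylor := by unfold expTaylor; fun_prop
  have hE : Continuous fun t : ℝ => Real.exp (-(t ^ 2 / 2)) := by fun_prop
  have e1 : ∫ t in (0 : ℝ)..x, expTaylor t = x - x ^ 3 / 6 + x ^ 5 / 40 - x ^ 7 / 336
      + x ^ 9 / 3456 - x ^ 11 / 42240 + x ^ 13 / 599040 := by
    have hd : ∀ t ∈ Set.uIcc 0 x, HasDerivAt (fun x : ℝ => x - x ^ 3 / 6 + x ^ 5 / 40 - x ^ 7 / 336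
      + x ^ 9 / 3456 - x ^ 11 / 42240 + x ^ 13 / 599040) (expTaylor t) t := by
      intro t _
      have := ((((((hasDerivAt_id t).sub ((hasDerivAt_pow 3 t).div_const 6)).add
        ((hasDerivAt_pow 5 t).div_const 40)).sub ((hasDerivAt_pow 7 t).div_const 336)).add
        ((hasDerivAt_pow 9 t).div_const 3456)).sub ((hasDerivAt_pow 11 t).div_const 42240)).add
        ((hasDerivAt_pow 13 t).div_const 599040)
      convert! this using 1
      unfold expTaylor
      norm_num
      ring
    rw [intervalIntegral.integral_eq_sub_of_hasDerivAt hd (hT.intervalIntegrable _ _)]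
    norm_num
  have e2 : ∫ t in (0 : ℝ)..x, t ^ 14 / 564480 = x ^ 15 / 8467200 := by
    rw [intervalIntegral.integral_div, integral_pow]
    norm_num
    ring
  rw [← e1, ← e2, ← intervalIntegral.integral_sub (hE.intervalIntegrable _ _)
    (hT.intervalIntegrable _ _)]
  refine (intervalIntegral.abs_integral_le_integral_abs hx).trans ?_
  refine intervalIntegral.integral_mono_on hx
    ((hE.sub hT).abs.intervalIntegrable _ _) (Continuous.intervalIntegrable (by fun_prop) _ _) ?_
  intro t ht
  exact abs_exp_sub_expTaylor (by nlinarith [ht.1, ht.2])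

theorem cdf_gaussian_eq (x : ℝ) : cdf (gaussianReal 0 1) x
    = 1 / 2 + (√(2 * Real.pi))⁻¹ * ∫ t in (0 : ℝ)..x, Real.exp (-(t ^ 2 / 2)) := by
  rw [← intervalIntegral.integral_const_mul, ← cdf_gaussian_zero]
  simp_rw [← gaussianPDFReal_std]
  rw [← cdf_gaussian_sub]
  ring

theorem sqrt_two_pi_bounds : 2.50662 < √(2 * Real.pi) ∧ √(2 * Real.pi) < 2.50664 := by
  constructor
  · apply Real.lt_sqrt_of_sq_lt
    nlinarith [Real.pi_gt_d6]
  · rw [Real.sqrt_lt' (by norm_num)]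
    nlinarith [Real.pi_lt_d6]

theorem cdf_gaussian_small : cdf (gaussianReal 0 1) 0.841 < 0.8 := by
  obtain ⟨h1, h2⟩ := sqrt_two_pi_bounds
  have h := (abs_le.1 (abs_integral_exp_sub_le (x := 0.841) (by norm_num) (by norm_num))).2
  rw [cdf_gaussian_eq]
  have : (∫ t in (0 : ℝ)..0.841, Real.exp (-(t ^ 2 / 2))) ≤ 0.75159 := by
    refine (sub_le_iff_le_add.1 h).trans ?_
    norm_num
  have h3 : (√(2 * Real.pi))⁻¹ * (∫ t in (0 : ℝ)..0.841, Real.exp (-(t ^ 2 / 2))) < 0.3 := by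
    rw [inv_mul_lt_iff₀ (by linarith)]
    linarith
  linarith

/-- The base point for `cdf_gaussian_mul_ge`. The factor 1.5252 lies between z_{0.1}/z_{0.2} ≈
1.5227 and about 1.52525, the largest ratio that the final constant 8.85 allows. -/
theorem cdf_gaussian_numeric :
    0 ≤ 2 * cdf (gaussianReal 0 1) (1.5252 * 0.841) - cdf (gaussianReal 0 1) 0.841 - 1 := by
  obtain ⟨h1, h2⟩ := sqrt_two_pi_bounds
  have h := (abs_le.1 (abs_integral_exp_sub_le (x := 0.841) (by norm_num) (by norm_num))).2
  have h' := (abs_le.1 (abs_integral_exp_sub_le (x := 1.5252 * 0.841)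
    (by norm_num) (by norm_num))).1
  rw [cdf_gaussian_eq, cdf_gaussian_eq]
  have e1 : (∫ t in (0 : ℝ)..0.841, Real.exp (-(t ^ 2 / 2))) ≤ 0.75159 := by
    refine (sub_le_iff_le_add.1 h).trans ?_
    norm_num
  have e2 : 1.00300 ≤ ∫ t in (0 : ℝ)..(1.5252 * 0.841), Real.exp (-(t ^ 2 / 2)) := by
    refine le_trans ?_ (le_sub_iff_add_le.1 h')
    norm_num
  have h3 : (1 / 2 : ℝ) ≤ (√(2 * Real.pi))⁻¹ *
      (2 * (∫ t in (0 : ℝ)..(1.5252 * 0.841), Real.exp (-(t ^ 2 / 2)))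
        - ∫ t in (0 : ℝ)..0.841, Real.exp (-(t ^ 2 / 2))) := by
    rw [le_inv_mul_iff₀ (by linarith)]
    linarith
  linarith

theorem gaussianPDFReal_std_anti {x y : ℝ} (hx : 0 ≤ x) (hxy : x ≤ y) :
    gaussianPDFReal 0 1 y ≤ gaussianPDFReal 0 1 x := by
  rw [gaussianPDFReal_std, gaussianPDFReal_std]
  gcongr

/-- A tail comparison: `1 - Φ (c x) ≤ (1 - Φ x) / 2` for `c = 1.5252` and `x ≥ 0.841`. -/
theorem cdf_gaussian_mul_ge {x : ℝ} (hx : 0.841 ≤ x) :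
    (1 + cdf (gaussianReal 0 1) x) / 2 ≤ cdf (gaussianReal 0 1) (1.5252 * x) := by
  have hnum := cdf_gaussian_numeric
  obtain ⟨k, hk⟩ : ∃ k : ℝ, k = 1.5252 := ⟨_, rfl⟩
  rw [← hk] at hnum ⊢
  -- The claim is g x ≥ 0. On the positive axis g first increases and then decreases, with limit 0
  -- at infinity; so g x is at least g 0.841 or at least that limit.
  set g : ℝ → ℝ := fun y => 2 * cdf (gaussianReal 0 1) (k * y) - cdf (gaussianReal 0 1) y - 1
  have hd : ∀ y, HasDerivAt g (2 * (gaussianPDFReal 0 1 (k * y) * k) - gaussianPDFReal 0 1 y) y := by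
    intro y
    have h1 : HasDerivAt (fun y => k * y) k y := by simpa using (hasDerivAt_id y).const_mul k
    exact ((((hasDerivAt_cdf_gaussian (k * y)).comp y h1).const_mul 2).sub
      (hasDerivAt_cdf_gaussian y)).sub_const 1
  have hcont : Continuous g := continuous_iff_continuousAt.2 fun y => (hd y).continuousAt
  have hdiff : Differentiable ℝ g := fun y => (hd y).differentiableAt
  -- the sign of the derivative
  have hfac : ∀ y, 2 * (gaussianPDFReal 0 1 (k * y) * k) - gaussianPDFReal 0 1 y
      = gaussianPDFReal 0 1 y * (2 * k * Real.exp (-((k ^ 2 - 1) * y ^ 2 / 2)) - 1) := by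
    intro y
    rw [gaussianPDFReal_std, gaussianPDFReal_std]
    have : Real.exp (-((k * y) ^ 2 / 2))
        = Real.exp (-(y ^ 2 / 2)) * Real.exp (-((k ^ 2 - 1) * y ^ 2 / 2)) := by
      rw [← Real.exp_add]; congr 1; ring
    rw [this]; ring
  have hk1 : 0 < k ^ 2 - 1 := by rw [hk]; norm_num
  -- The unique positive zero of g', where 2k · exp(-(k² - 1)y²/2) = 1.
  set y₀ : ℝ := √(2 * Real.log (2 * k) / (k ^ 2 - 1)) with hy₀
  have hlog : 0 < Real.log (2 * k) := Real.log_pos (by rw [hk]; norm_num)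
  have hy₀sq : (k ^ 2 - 1) * y₀ ^ 2 / 2 = Real.log (2 * k) := by
    rw [hy₀, Real.sq_sqrt (by positivity)]
    field_simp
  have hval : 2 * k * Real.exp (-((k ^ 2 - 1) * y₀ ^ 2 / 2)) = 1 := by
    rw [hy₀sq, Real.exp_neg, Real.exp_log (by rw [hk]; norm_num)]
    exact mul_inv_cancel₀ (by rw [hk]; norm_num)
  have hkpos : 0 < 2 * k := by rw [hk]; norm_num
  have hy₀0 : 0 ≤ y₀ := Real.sqrt_nonneg _
  have hmono : MonotoneOn g (Set.Icc 0 y₀) := by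
    refine monotoneOn_of_deriv_nonneg (convex_Icc _ _) hcont.continuousOn hdiff.differentiableOn ?_
    intro y hy
    rw [interior_Icc] at hy
    rw [(hd y).deriv, hfac]
    refine mul_nonneg (gaussianPDFReal_nonneg _ _ _) ?_
    rw [sub_nonneg]
    refine hval.symm.le.trans ?_
    have : y ^ 2 ≤ y₀ ^ 2 := pow_le_pow_left₀ hy.1.le hy.2.le 2
    gcongr
  have hanti : AntitoneOn g (Set.Ici y₀) := by
    refine antitoneOn_of_deriv_nonpos (convex_Ici _) hcont.continuousOn hdiff.differentiableOn ?_
    intro y hy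
    rw [interior_Ici] at hy
    rw [(hd y).deriv, hfac]
    refine mul_nonpos_of_nonneg_of_nonpos (gaussianPDFReal_nonneg _ _ _) ?_
    rw [sub_nonpos]
    refine le_trans ?_ hval.le
    have : y₀ ^ 2 ≤ y ^ 2 := pow_le_pow_left₀ hy₀0 (le_of_lt hy) 2
    gcongr
  have hlim : Filter.Tendsto g Filter.atTop (nhds 0) := by
    have h1 := tendsto_cdf_atTop (gaussianReal 0 1)
    have h2 := h1.comp (Filter.tendsto_id.const_mul_atTop (by rw [hk]; norm_num : 0 < k))
    have := ((h2.const_mul 2).sub h1).sub_const 1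
    rwa [show (2 * 1 - 1 - 1 : ℝ) = 0 by norm_num] at this
  have hgx : 0 ≤ g x := by
    rcases le_total x y₀ with h | h
    · have h0 : 0 ≤ g 0.841 := hnum
      exact h0.trans (hmono ⟨by norm_num, hx.trans h⟩ ⟨le_trans (by norm_num) hx, h⟩ hx)
    · refine le_of_tendsto hlim ?_
      filter_upwards [Filter.eventually_ge_atTop x] with y hy
      exact hanti h (h.trans hy) hy
  have : 0 ≤ 2 * cdf (gaussianReal 0 1) (k * x) - cdf (gaussianReal 0 1) x - 1 := hgx
  linarith

/-- Midpoint concavity of Φ on the positive axis, with Φ(0) = 1/2. At x = z_α, where Φ ≥ 0.8, it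
yields the rejection bound 0.35. -/
theorem cdf_gaussian_half_ge {x : ℝ} (hx : 0 ≤ x) :
    (1 / 2 + cdf (gaussianReal 0 1) x) / 2 ≤ cdf (gaussianReal 0 1) (x / 2) := by
  set g : ℝ → ℝ := fun y => 2 * cdf (gaussianReal 0 1) (y / 2) - cdf (gaussianReal 0 1) y
  have hd : ∀ y, HasDerivAt g
      (2 * (gaussianPDFReal 0 1 (y / 2) * (1 / 2)) - gaussianPDFReal 0 1 y) y := by
    intro y
    have h1 : HasDerivAt (fun y : ℝ => y / 2) (1 / 2) y := (hasDerivAt_id y).div_const 2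
    exact ((((hasDerivAt_cdf_gaussian (y / 2)).comp y h1).const_mul 2).sub
      (hasDerivAt_cdf_gaussian y))
  have hmono : MonotoneOn g (Set.Ici 0) := by
    refine monotoneOn_of_deriv_nonneg (convex_Ici _)
      (continuous_iff_continuousAt.2 fun y => (hd y).continuousAt).continuousOn
      (fun y _ => (hd y).differentiableAt.differentiableWithinAt) ?_
    intro y hy
    rw [interior_Ici] at hy
    have hy' : (0 : ℝ) < y := hy
    rw [(hd y).deriv]
    linarith [gaussianPDFReal_std_anti (x := y / 2) (y := y) (by linarith) (by linarith)]
  have h := hmono (Set.self_mem_Ici) hx hx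
  have h0 : g 0 = 1 / 2 := by
    simp only [g, zero_div, cdf_gaussian_zero]
    norm_num
  rw [h0] at h
  have : 1 / 2 ≤ 2 * cdf (gaussianReal 0 1) (x / 2) - cdf (gaussianReal 0 1) x := h
  linarith

theorem zQuantile_ge {α : ℝ} (h0 : 0 < α) (h1 : α ≤ 0.2) : 0.841 ≤ zQuantile α := by
  have h := le_cdf_zQuantile h0 (by linarith)
  by_contra! hlt
  have := monotone_cdf (gaussianReal 0 1) hlt.le
  linarith [cdf_gaussian_small]

theorem zQuantile_half_le {α : ℝ} (h0 : 0 < α) (h1 : α ≤ 0.2) :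
    zQuantile (α / 2) ≤ 1.5252 * zQuantile α := by
  refine zQuantile_le (by linarith) ?_
  have := cdf_gaussian_mul_ge (zQuantile_ge h0 h1)
  have := le_cdf_zQuantile h0 (by linarith)
  linarith

theorem gaussian_Ioi_half_zQuantile {α : ℝ} (h0 : 0 < α) (h1 : α ≤ 0.2) :
    (gaussianReal 0 1).real (Set.Ioi (zQuantile α / 2)) ≤ 0.35 := by
  rw [gaussian_Ioi]
  have := cdf_gaussian_half_ge (x := zQuantile α) (by linarith [zQuantile_ge h0 h1])
  have := le_cdf_zQuantile h0 (by linarith)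
  linarith

/-! ### Gaussian laws -/

section Laws

variable {Ω : Type*} [MeasurableSpace Ω] {P : Measure Ω} {X X' : Ω → ℝ} {m m' v v' : ℝ}

theorem hasLaw_mul_sub (hX : HasLaw X (gaussianReal m (Real.toNNReal v)) P)
    (hX' : HasLaw X' (gaussianReal m' (Real.toNNReal v')) P) (hi : IndepFun X X' P)
    (hv : 0 ≤ v) (hv' : 0 ≤ v') (c : ℝ) :
    HasLaw (fun ω => c * X ω - c * X' ω)
      (gaussianReal (c * m - c * m') (Real.toNNReal (c ^ 2 * (v + v')))) P := by
  have h1 := gaussianReal_const_mul hX c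
  have h2 := gaussianReal_const_mul hX' (-c)
  have hi2 : IndepFun (fun ω => c * X ω) (fun ω => -c * X' ω) P :=
    hi.comp (φ := fun x => c * x) (ψ := fun x => -c * x) (by fun_prop) (by fun_prop)
  have h3 : HasLaw ((fun ω => c * X ω) + fun ω => -c * X' ω) _ P :=
    ⟨h1.aemeasurable.add h2.aemeasurable,
      gaussianReal_add_gaussianReal_of_indepFun hi2 h1.map_eq h2.map_eq⟩
  have e1 : ((fun ω => c * X ω) + fun ω => -c * X' ω) = fun ω => c * X ω - c * X' ω := by
    funext ω
    simp only [Pi.add_apply]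
    ring
  rw [e1] at h3
  convert h3 using 2
  · ring
  · apply NNReal.coe_injective
    push_cast
    rw [Real.coe_toNNReal _ (by positivity), Real.coe_toNNReal _ hv, Real.coe_toNNReal _ hv']
    ring

theorem hasLaw_mul (hX : HasLaw X (gaussianReal m (Real.toNNReal v)) P)
    (hv : 0 ≤ v) (c : ℝ) :
    HasLaw (fun ω => c * X ω) (gaussianReal (c * m) (Real.toNNReal (c ^ 2 * v))) P := by
  convert gaussianReal_const_mul hX c using 2
  apply NNReal.coe_injective
  push_cast
  rw [Real.coe_toNNReal _ (by positivity), Real.coe_toNNReal _ hv]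

theorem hasLaw_standardize {s : ℝ} (hX : HasLaw X (gaussianReal m (Real.toNNReal (s ^ 2))) P)
    (hs : 0 < s) : HasLaw (fun ω => (X ω - m) / s) (gaussianReal 0 1) P := by
  convert gaussianReal_div_const (gaussianReal_sub_const hX m) s using 2
  · simp
  · apply NNReal.coe_injective
    push_cast
    rw [Real.coe_toNNReal _ (by positivity)]
    rw [div_self (by positivity)]

theorem real_gt_of_hasLaw {s : ℝ} (hX : HasLaw X (gaussianReal m (Real.toNNReal (s ^ 2))) P)
    (hs : 0 < s) (x : ℝ) :
    P.real {ω | m + x * s < X ω} = 1 - cdf (gaussianReal 0 1) x := by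
  rw [← gaussian_Ioi]
  refine Eq.trans ?_ ((hasLaw_standardize hX hs).measureReal_eq (p := fun y => x < y)
    measurableSet_Ioi)
  congr 1
  ext ω
  simp only [Set.mem_ofPred_eq]
  rw [lt_div_iff₀ hs]
  constructor <;> intro h <;> linarith

theorem real_lt_of_hasLaw {s : ℝ} (hX : HasLaw X (gaussianReal m (Real.toNNReal (s ^ 2))) P)
    (hs : 0 < s) (x : ℝ) :
    P.real {ω | X ω < m - x * s} = 1 - cdf (gaussianReal 0 1) x := by
  rw [← gaussian_Iio_neg]
  refine Eq.trans ?_ ((hasLaw_standardize hX hs).measureReal_eq (p := fun y => y < -x)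
    measurableSet_Iio)
  congr 1
  ext ω
  simp only [Set.mem_ofPred_eq]
  rw [div_lt_iff₀ hs]
  constructor <;> intro h <;> linarith

theorem memLp_of_hasLaw {w : NNReal} (hX : HasLaw X (gaussianReal m w) P) : MemLp X 2 P := by
  have h : MemLp id 2 (Measure.map X P) := by
    rw [hX.map_eq]
    exact memLp_id_gaussianReal 2
  exact h.comp_of_map hX.aemeasurable

theorem integral_of_hasLaw {w : NNReal} (hX : HasLaw X (gaussianReal m w) P) :
    ∫ ω, X ω ∂P = m := by
  rw [hX.integral_eq, integral_id_gaussianReal]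

theorem integral_sq_of_hasLaw (hX : HasLaw X (gaussianReal m (Real.toNNReal v)) P)
    (hv : 0 ≤ v) : ∫ ω, (X ω - m) ^ 2 ∂P = v := by
  have h := hX.variance_eq
  rw [variance_id_gaussianReal, Real.coe_toNNReal _ hv,
    variance_eq_integral hX.aemeasurable, integral_of_hasLaw hX] at h
  exact h

end Laws

/-! ### Increments of the white noise observation -/

section Increments

variable {Ω : Type*} [MeasurableSpace Ω] {P : Measure Ω} {f : ℝ → ℝ} {n : ℝ} {Y : ℝ → Ω → ℝ}

/-- Increments of a Brownian motion over essentially disjoint families of intervals are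
independent. -/
theorem indepFun_brownian_increments {W : NNReal → Ω → ℝ} (hW : IsPreBrownianReal W P)
    {S T : Type*} (p : S → NNReal × NNReal) (q : T → NNReal × NNReal)
    (hp : ∀ s, (p s).1 ≤ (p s).2) (hq : ∀ t, (q t).1 ≤ (q t).2)
    (hpq : ∀ s t, (p s).2 ≤ (q t).1 ∨ (q t).2 ≤ (p s).1) :
    IndepFun (fun ω s => W (p s).2 ω - W (p s).1 ω) (fun ω t => W (q t).2 ω - W (q t).1 ω) P := by
  have hG := hW.isGaussianProcess
  have : IsProbabilityMeasure P := hG.isProbabilityMeasure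
  -- The increments are linear images of a Gaussian process, hence jointly Gaussian, and vanishing
  -- covariances suffice for independence.
  have hD : IsGaussianProcess (fun (r : NNReal × NNReal) ω => W r.2 ω - W r.1 ω) P := by
    classical
    exact hG.of_isGaussianProcess fun r => ⟨{r.2, r.1},
      { toFun x := x ⟨r.2, by simp⟩ - x ⟨r.1, by simp⟩
        map_add' x y := by simp; abel
        map_smul' c x := by simp; ring }, by simp⟩
  have hM : ∀ t, MemLp (W t) 2 P := fun t => (hG.hasGaussianLaw_eval t).memLp_two
  refine IsGaussianProcess.indepFun_of_covariance_eq_zero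
    (X := fun s ω => W (p s).2 ω - W (p s).1 ω) (Y := fun t ω => W (q t).2 ω - W (q t).1 ω)
    ?_ (fun s => (hW.aemeasurable _).sub (hW.aemeasurable _))
    (fun s => (hW.aemeasurable _).sub (hW.aemeasurable _)) ?_
  · have e : Sum.elim (fun s ω => W (p s).2 ω - W (p s).1 ω) (fun t ω => W (q t).2 ω - W (q t).1 ω)
        = (fun (r : NNReal × NNReal) ω => W r.2 ω - W r.1 ω) ∘ Sum.elim p q := by
      funext u
      cases u <;> rfl
    rw [e]
    exact hD.comp_right (Sum.elim p q)
  · intro s t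
    rw [covariance_fun_sub_fun_sub (hM _) (hM _) (hM _) (hM _)]
    simp only [hW.covariance_eval]
    have h1 := hp s
    have h2 := hq t
    rcases hpq s t with h | h
    · rw [min_eq_left (h.trans h2), min_eq_left h, min_eq_left (h1.trans (h.trans h2)),
        min_eq_left (h1.trans h)]
      ring
    · rw [min_eq_right (h.trans h1), min_eq_right (h2.trans (h.trans h1)), min_eq_right h,
        min_eq_right (h2.trans h)]
      ring

/-- One null set serves all pairs of endpoints, so whole families of increments can be replaced at
once. -/
theorem ae_increment {W : NNReal → Ω → ℝ}
    (hf : MonotoneOn f (Set.Icc (-(1 / 2) : ℝ) (1 / 2)))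
    (hY : ∀ᵐ ω ∂P, ∀ t ∈ Set.Icc (-(1 / 2) : ℝ) (1 / 2),
      Y t ω - Y (-(1 / 2)) ω =
        (∫ u in (-(1 / 2) : ℝ)..t, f u) + n ^ (-(1 / 2) : ℝ) * W (Real.toNNReal (t + 1 / 2)) ω) :
    ∀ᵐ ω ∂P, ∀ a ∈ Set.Icc (-(1 / 2) : ℝ) (1 / 2), ∀ b ∈ Set.Icc (-(1 / 2) : ℝ) (1 / 2),
      Y b ω - Y a ω = (∫ u in a..b, f u) +
        n ^ (-(1 / 2) : ℝ) * (W (Real.toNNReal (b + 1 / 2)) ω - W (Real.toNNReal (a + 1 / 2)) ω) := by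
  have hint : ∀ a ∈ Set.Icc (-(1 / 2) : ℝ) (1 / 2), ∀ b ∈ Set.Icc (-(1 / 2) : ℝ) (1 / 2),
      IntervalIntegrable f volume a b := fun a ha b hb =>
    (hf.mono (Set.uIcc_subset_Icc ha hb)).intervalIntegrable
  have h0 : (-(1 / 2) : ℝ) ∈ Set.Icc (-(1 / 2) : ℝ) (1 / 2) := by constructor <;> norm_num
  filter_upwards [hY] with ω h a ha b hb
  have h1 := h a ha
  have h2 := h b hb
  have h3 := intervalIntegral.integral_interval_sub_left (hint _ h0 b hb) (hint _ h0 a ha)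
  rw [← h3]
  linear_combination h2 - h1

theorem hasLaw_increment (hn : 0 < n) (hf : MonotoneOn f (Set.Icc (-(1 / 2) : ℝ) (1 / 2)))
    (hY : IsWhiteNoiseObservation f n Y P) {a b : ℝ} (ha : -(1 / 2) ≤ a) (hab : a ≤ b)
    (hb : b ≤ 1 / 2) :
    HasLaw (fun ω => Y b ω - Y a ω)
      (gaussianReal (∫ u in a..b, f u) (Real.toNNReal ((b - a) / n))) P := by
  obtain ⟨W, hW, hYW⟩ := hY
  have h1 := hW.toIsPreBrownianReal.hasLaw_sub (Real.toNNReal (b + 1 / 2))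
    (Real.toNNReal (a + 1 / 2))
  have h2 := gaussianReal_const_add (gaussianReal_const_mul h1 (n ^ (-(1 / 2) : ℝ)))
    (∫ u in a..b, f u)
  convert h2.congr ?_ using 2
  · ring
  · apply NNReal.coe_injective
    push_cast
    change _ = (n ^ (-(1 / 2) : ℝ)) ^ 2 *
      |((Real.toNNReal (b + 1 / 2) : NNReal) : ℝ) - ((Real.toNNReal (a + 1 / 2) : NNReal) : ℝ)|
    rw [Real.coe_toNNReal _ (div_nonneg (by linarith) hn.le),
      Real.coe_toNNReal (b + 1 / 2) (by linarith), Real.coe_toNNReal (a + 1 / 2) (by linarith)]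
    rw [← Real.rpow_natCast, ← Real.rpow_mul hn.le, abs_of_nonneg (by linarith)]
    norm_num
    rw [Real.rpow_neg_one]
    ring
  · filter_upwards [ae_increment hf hYW] with ω h
    rw [h a ⟨ha, hab.trans hb⟩ b ⟨ha.trans hab, hb⟩]
    rfl

/-- Almost surely the increments of `Y` are affine images of those of `W`, so independence transfers
coordinatewise. -/
theorem indepFun_increments (hf : MonotoneOn f (Set.Icc (-(1 / 2) : ℝ) (1 / 2)))
    (hY : IsWhiteNoiseObservation f n Y P) {S T : Type*} (p : S → ℝ × ℝ) (q : T → ℝ × ℝ)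
    (hp : ∀ s, -(1 / 2) ≤ (p s).1 ∧ (p s).1 ≤ (p s).2 ∧ (p s).2 ≤ 1 / 2)
    (hq : ∀ t, -(1 / 2) ≤ (q t).1 ∧ (q t).1 ≤ (q t).2 ∧ (q t).2 ≤ 1 / 2)
    (hpq : ∀ s t, (p s).2 ≤ (q t).1 ∨ (q t).2 ≤ (p s).1) :
    IndepFun (fun ω s => Y (p s).2 ω - Y (p s).1 ω) (fun ω t => Y (q t).2 ω - Y (q t).1 ω) P := by
  obtain ⟨W, hW, hYW⟩ := hY
  have hmono : ∀ {x y : ℝ}, x ≤ y → Real.toNNReal (x + 1 / 2) ≤ Real.toNNReal (y + 1 / 2) :=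
    fun h => Real.toNNReal_le_toNNReal (by linarith)
  have h := indepFun_brownian_increments hW.toIsPreBrownianReal
    (fun s => (Real.toNNReal ((p s).1 + 1 / 2), Real.toNNReal ((p s).2 + 1 / 2)))
    (fun t => (Real.toNNReal ((q t).1 + 1 / 2), Real.toNNReal ((q t).2 + 1 / 2)))
    (fun s => hmono (hp s).2.1) (fun t => hmono (hq t).2.1)
    (fun s t => (hpq s t).imp hmono hmono)
  have h' := h.comp
    (φ := fun x s => (∫ u in (p s).1..(p s).2, f u) + n ^ (-(1 / 2) : ℝ) * x s)
    (ψ := fun x t => (∫ u in (q t).1..(q t).2, f u) + n ^ (-(1 / 2) : ℝ) * x t)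
    (by fun_prop) (by fun_prop)
  have hI := ae_increment hf hYW
  refine h'.congr ?_ ?_
  · filter_upwards [hI] with ω hω
    funext s
    obtain ⟨h1, h2, h3⟩ := hp s
    exact (hω _ ⟨h1, h2.trans h3⟩ _ ⟨h1.trans h2, h3⟩).symm
  · filter_upwards [hI] with ω hω
    funext s
    obtain ⟨h1, h2, h3⟩ := hq s
    exact (hω _ ⟨h1, h2.trans h3⟩ _ ⟨h1.trans h2, h3⟩).symm

end Increments

/-! ### Dyadic scales -/

/-- The dyadic length `2⁻ʲ`. -/
noncomputable def dyadic (j : ℕ) : ℝ := (2 : ℝ) ^ (-(j : ℤ))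

theorem dyadic_pos (j : ℕ) : 0 < dyadic j := by unfold dyadic; positivity

theorem dyadic_succ (j : ℕ) : dyadic (j + 1) = dyadic j / 2 := by
  unfold dyadic
  rw [Nat.cast_succ, neg_add, zpow_add₀ two_ne_zero]
  norm_num
  ring

theorem dyadic_anti : Antitone dyadic :=
  antitone_nat_of_succ_le fun j => by rw [dyadic_succ]; linarith [dyadic_pos j]

theorem two_mul_dyadic_le {i j : ℕ} (h : i < j) : 2 * dyadic j ≤ dyadic i := by
  have := dyadic_anti h
  rw [Nat.succ_eq_add_one, dyadic_succ] at this
  linarith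

theorem dyadic_le {j : ℕ} (hj : 2 ≤ j) : dyadic j ≤ 1 / 4 := by
  refine (dyadic_anti hj).trans (le_of_eq ?_)
  norm_num [dyadic]

theorem two_zpow_neg_add_one (j : ℕ) : (2 : ℝ) ^ (-(j : ℤ) + 1) = 2 * dyadic j := by
  rw [zpow_add₀ two_ne_zero, dyadic]; ring

theorem two_zpow_sub_one (j : ℕ) : (2 : ℝ) ^ ((j : ℤ) - 1) = (2 * dyadic j)⁻¹ := by
  rw [← two_zpow_neg_add_one, ← zpow_neg]; congr 1; ring

theorem two_pow_eq (j : ℕ) : (2 : ℝ) ^ j = (dyadic j)⁻¹ := by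
  rw [dyadic, ← zpow_neg, neg_neg, zpow_natCast]

theorem sigma_sq {n : ℝ} (hn : 0 < n) (j : ℕ) : sigma n j ^ 2 = (2 * dyadic j)⁻¹ / n := by
  have := dyadic_pos j
  rw [sigma, two_zpow_sub_one, Real.sq_sqrt (by positivity)]

theorem sigma_pos {n : ℝ} (hn : 0 < n) (j : ℕ) : 0 < sigma n j :=
  Real.sqrt_pos.2 (by positivity)

theorem sigma_succ (n : ℝ) (j : ℕ) : sigma n (j + 1) = √2 * sigma n j := by
  have := dyadic_pos j
  rw [sigma, sigma, two_zpow_sub_one, two_zpow_sub_one, dyadic_succ, ← Real.sqrt_mul (by norm_num)]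
  congr 1
  field_simp

theorem sigma_mono (n : ℝ) : Monotone (sigma n) :=
  monotone_nat_of_le_succ fun j => by
    rw [sigma_succ]
    exact le_mul_of_one_le_left (Real.sqrt_nonneg _) (Real.one_le_sqrt.2 (by norm_num))

theorem tendsto_sigma {n : ℝ} (hn : 0 < n) :
    Filter.Tendsto (sigma n) Filter.atTop Filter.atTop := by
  have h : ∀ j, sigma n j = sigma n 0 * √2 ^ j := by
    intro j
    induction j with
    | zero => simp
    | succ j ih => rw [sigma_succ, ih]; ring
  have h2 : Filter.Tendsto (fun j => sigma n 0 * √2 ^ j) Filter.atTop Filter.atTop :=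
    (tendsto_pow_atTop_atTop_of_one_lt (Real.lt_sqrt_of_sq_lt (by norm_num))).const_mul_atTop
      (sigma_pos hn 0)
  exact h2.congr fun j => (h j).symm

/-! ### Means of the local averages -/

/-- The mean of `deltaR`. -/
noncomputable def driftR (f : ℝ → ℝ) (j : ℕ) : ℝ := (dyadic j)⁻¹ * ∫ u in (0 : ℝ)..dyadic j, f u

/-- The mean of `deltaL`. -/
noncomputable def driftL (f : ℝ → ℝ) (j : ℕ) : ℝ := (dyadic j)⁻¹ * ∫ u in (-dyadic j)..0, f u

/-- The mean of `xi`. -/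
noncomputable def driftXi (f : ℝ → ℝ) (j : ℕ) : ℝ :=
  (2 * dyadic j)⁻¹ * (∫ u in (dyadic j)..(2 * dyadic j), f u)
    - (2 * dyadic j)⁻¹ * ∫ u in (-(2 * dyadic j))..(-dyadic j), f u

section Drift

variable {f : ℝ → ℝ} {j : ℕ}

theorem integral_mem_of_monotoneOn (hf : MonotoneOn f (Set.Icc (-(1 / 2) : ℝ) (1 / 2))) {a b : ℝ}
    (ha : -(1 / 2) ≤ a) (hab : a ≤ b) (hb : b ≤ 1 / 2) :
    (b - a) * f a ≤ ∫ u in a..b, f u ∧ ∫ u in a..b, f u ≤ (b - a) * f b := by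
  have hI : IntervalIntegrable f volume a b :=
    (hf.mono (Set.uIcc_subset_Icc ⟨ha, hab.trans hb⟩ ⟨ha.trans hab, hb⟩)).intervalIntegrable
  have hc : ∀ c : ℝ, ∫ _ in a..b, c = (b - a) * c := fun c => by simp
  have hmem : ∀ u ∈ Set.Icc a b, u ∈ Set.Icc (-(1 / 2) : ℝ) (1 / 2) :=
    fun u hu => ⟨ha.trans hu.1, hu.2.trans hb⟩
  rw [← hc, ← hc]
  constructor
  · refine intervalIntegral.integral_mono_on hab intervalIntegrable_const hI fun u hu => ?_
    exact hf (hmem a ⟨le_rfl, hab⟩) (hmem u hu) hu.1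
  · refine intervalIntegral.integral_mono_on hab hI intervalIntegrable_const fun u hu => ?_
    exact hf (hmem u hu) (hmem b ⟨hab, le_rfl⟩) hu.2

theorem le_driftR (hf : MonotoneOn f (Set.Icc (-(1 / 2) : ℝ) (1 / 2))) (hj : 2 ≤ j) :
    f 0 ≤ driftR f j := by
  have h0 := dyadic_pos j
  have h1 := dyadic_le hj
  have h := (integral_mem_of_monotoneOn hf (a := 0) (b := dyadic j) (by norm_num) h0.le
    (by linarith)).1
  rw [driftR, le_inv_mul_iff₀ h0]
  linarith

theorem driftL_le (hf : MonotoneOn f (Set.Icc (-(1 / 2) : ℝ) (1 / 2))) (hj : 2 ≤ j) :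
    driftL f j ≤ f 0 := by
  have h0 := dyadic_pos j
  have h1 := dyadic_le hj
  have h := (integral_mem_of_monotoneOn hf (a := -dyadic j) (b := 0) (by linarith) (by linarith)
    (by linarith)).2
  rw [driftL, inv_mul_le_iff₀ h0]
  linarith

theorem two_mul_driftXi_eq : 2 * driftXi f j
    = (dyadic j)⁻¹ * (∫ u in (dyadic j)..(2 * dyadic j), f u)
    - (dyadic j)⁻¹ * ∫ u in (-(2 * dyadic j))..(-dyadic j), f u := by
  rw [driftXi, mul_inv]
  ring

/-- The weight in ξ_j is 2^{j-1}, half the reciprocal interval length, so twice its mean is a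
difference of averages of f, over points beyond 2⁻ʲ and below -2⁻ʲ. -/
theorem le_two_mul_driftXi (hf : MonotoneOn f (Set.Icc (-(1 / 2) : ℝ) (1 / 2))) (hj : 2 ≤ j) :
    f (dyadic j) - f (-dyadic j) ≤ 2 * driftXi f j := by
  have h0 := dyadic_pos j
  have h1 := dyadic_le hj
  have hR := (integral_mem_of_monotoneOn hf (a := dyadic j) (b := 2 * dyadic j) (by linarith)
    (by linarith) (by linarith)).1
  have hL := (integral_mem_of_monotoneOn hf (a := -(2 * dyadic j)) (b := -dyadic j) (by linarith)
    (by linarith) (by linarith)).2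
  rw [two_mul_driftXi_eq, ← mul_sub, le_inv_mul_iff₀ h0]
  linarith

/-- One scale finer, the intervals of ξ lie inside [-2⁻ʲ, 2⁻ʲ]. With `le_two_mul_driftXi`, the same
increment of f separates consecutive means, which gives `driftXi_anti`. -/
theorem two_mul_driftXi_succ_le (hf : MonotoneOn f (Set.Icc (-(1 / 2) : ℝ) (1 / 2)))
    (hj : 2 ≤ j) : 2 * driftXi f (j + 1) ≤ f (dyadic j) - f (-dyadic j) := by
  have h0 := dyadic_pos j
  have h1 := dyadic_le hj
  have hs := dyadic_succ j
  have hR := (integral_mem_of_monotoneOn hf (a := dyadic (j + 1)) (b := 2 * dyadic (j + 1))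
    (by linarith) (by linarith) (by linarith)).2
  have hL := (integral_mem_of_monotoneOn hf (a := -(2 * dyadic (j + 1))) (b := -dyadic (j + 1))
    (by linarith) (by linarith) (by linarith)).1
  have e : 2 * dyadic (j + 1) = dyadic j := by linarith
  rw [two_mul_driftXi_eq, ← mul_sub, inv_mul_le_iff₀ (dyadic_pos _)]
  rw [e] at hR hL ⊢
  rw [show -dyadic (j + 1) - -dyadic j = dyadic (j + 1) by linarith] at hL
  rw [show dyadic j - dyadic (j + 1) = dyadic (j + 1) by linarith] at hR
  linarith

theorem driftR_sub_driftL_le (hf : MonotoneOn f (Set.Icc (-(1 / 2) : ℝ) (1 / 2))) (hj : 2 ≤ j) :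
    driftR f j - driftL f j ≤ f (dyadic j) - f (-dyadic j) := by
  have h0 := dyadic_pos j
  have h1 := dyadic_le hj
  have hR := (integral_mem_of_monotoneOn hf (a := 0) (b := dyadic j) (by linarith)
    (by linarith) (by linarith)).2
  have hL := (integral_mem_of_monotoneOn hf (a := -dyadic j) (b := 0) (by linarith)
    (by linarith) (by linarith)).1
  rw [driftR, driftL, ← mul_sub, inv_mul_le_iff₀ h0]
  linarith

/-- Halving [0, 2⁻ʲ] leaves the interval of `deltaR` at scale j+1 and the right interval of ξ_{j+1};
likewise on the left. -/
theorem driftR_sub_driftL_eq (hf : MonotoneOn f (Set.Icc (-(1 / 2) : ℝ) (1 / 2))) (hj : 2 ≤ j) :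
    driftR f j - driftL f j = (driftR f (j + 1) - driftL f (j + 1)) / 2 + driftXi f (j + 1) := by
  have h0 := dyadic_pos j
  have h1 := dyadic_le hj
  have hs := dyadic_succ j
  have e : 2 * dyadic (j + 1) = dyadic j := by linarith
  have hI : ∀ a b : ℝ, -(1 / 2) ≤ a → a ≤ b → b ≤ 1 / 2 → IntervalIntegrable f volume a b :=
    fun a b ha hab hb =>
      (hf.mono (Set.uIcc_subset_Icc ⟨ha, hab.trans hb⟩ ⟨ha.trans hab, hb⟩)).intervalIntegrable
  have hR := intervalIntegral.integral_add_adjacent_intervals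
    (hI 0 (dyadic (j + 1)) (by linarith) (by linarith) (by linarith))
    (hI (dyadic (j + 1)) (dyadic j) (by linarith) (by linarith) (by linarith))
  have hL := intervalIntegral.integral_add_adjacent_intervals
    (hI (-dyadic j) (-dyadic (j + 1)) (by linarith) (by linarith) (by linarith))
    (hI (-dyadic (j + 1)) 0 (by linarith) (by linarith) (by linarith))
  have ei : (dyadic (j + 1))⁻¹ = 2 * (dyadic j)⁻¹ := by
    rw [hs, inv_div]
    ring
  rw [driftXi, driftR, driftL, driftR, driftL, e, ← hR, ← hL, ei]
  ring

theorem driftR_sub_driftL_le_succ (hf : MonotoneOn f (Set.Icc (-(1 / 2) : ℝ) (1 / 2)))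
    (hj : 2 ≤ j) : driftR f j - driftL f j ≤ 2 * driftXi f (j + 1) := by
  have h1 := driftR_sub_driftL_eq hf hj
  have h2 := driftR_sub_driftL_le hf (j := j + 1) (by omega)
  have h3 := le_two_mul_driftXi hf (j := j + 1) (by omega)
  linarith

theorem driftXi_anti (hf : MonotoneOn f (Set.Icc (-(1 / 2) : ℝ) (1 / 2))) {i : ℕ} (hi : 2 ≤ i)
    (hij : i ≤ j) : driftXi f j ≤ driftXi f i := by
  induction j, hij using Nat.le_induction with
  | base => exact le_rfl
  | succ j hij ih =>
    have h1 := two_mul_driftXi_succ_le hf (j := j) (by omega)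
    have h2 := le_two_mul_driftXi hf (j := j) (by omega)
    linarith

end Drift

/-! ### Laws and independence of the statistics -/

theorem xi_eq {Ω : Type*} (Y : ℝ → Ω → ℝ) (j : ℕ) (ω : Ω) : xi Y j ω =
    (2 * dyadic j)⁻¹ * (Y (2 * dyadic j) ω - Y (dyadic j) ω)
      - (2 * dyadic j)⁻¹ * (Y (-dyadic j) ω - Y (-(2 * dyadic j)) ω) := by
  rw [xi, two_zpow_neg_add_one, two_zpow_sub_one, dyadic]

theorem deltaR_eq {Ω : Type*} (Y : ℝ → Ω → ℝ) (j : ℕ) (ω : Ω) :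
    deltaR Y j ω = (dyadic j)⁻¹ * (Y (dyadic j) ω - Y 0 ω) := by
  rw [deltaR, two_pow_eq, dyadic]

theorem deltaL_eq {Ω : Type*} (Y : ℝ → Ω → ℝ) (j : ℕ) (ω : Ω) :
    deltaL Y j ω = (dyadic j)⁻¹ * (Y 0 ω - Y (-dyadic j) ω) := by
  rw [deltaL, two_pow_eq, dyadic]

section Statistics

variable {Ω : Type*} [MeasurableSpace Ω] {P : Measure Ω} {f : ℝ → ℝ} {n : ℝ} {Y : ℝ → Ω → ℝ}
  {j : ℕ}

theorem indepFun_increment (hf : MonotoneOn f (Set.Icc (-(1 / 2) : ℝ) (1 / 2)))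
    (hY : IsWhiteNoiseObservation f n Y P) {a b c d : ℝ} (ha : -(1 / 2) ≤ a) (hab : a ≤ b)
    (hbc : b ≤ c) (hcd : c ≤ d) (hd : d ≤ 1 / 2) :
    IndepFun (fun ω => Y d ω - Y c ω) (fun ω => Y b ω - Y a ω) P := by
  have h := indepFun_increments hf hY (fun _ : Unit => (c, d)) (fun _ : Unit => (a, b))
    (fun _ => ⟨by linarith, hcd, hd⟩) (fun _ => ⟨ha, hab, by linarith⟩) (fun _ _ => Or.inr hbc)
  exact h.comp (φ := fun x : Unit → ℝ => x ()) (ψ := fun x : Unit → ℝ => x ()) (by fun_prop)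
    (by fun_prop)

theorem hasLaw_xi (hn : 0 < n) (hf : MonotoneOn f (Set.Icc (-(1 / 2) : ℝ) (1 / 2)))
    (hY : IsWhiteNoiseObservation f n Y P) (hj : 2 ≤ j) :
    HasLaw (xi Y j) (gaussianReal (driftXi f j) (Real.toNNReal (sigma n j ^ 2))) P := by
  have h0 := dyadic_pos j
  have h1 := dyadic_le hj
  have h := hasLaw_mul_sub
    (hasLaw_increment hn hf hY (a := dyadic j) (b := 2 * dyadic j) (by linarith) (by linarith)
      (by linarith))
    (hasLaw_increment hn hf hY (a := -(2 * dyadic j)) (b := -dyadic j) (by linarith)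
      (by linarith) (by linarith))
    (indepFun_increment hf hY (by linarith) (by linarith) (by linarith) (by linarith)
      (by linarith)) (div_nonneg (by linarith) hn.le) (div_nonneg (by linarith) hn.le)
    ((2 * dyadic j)⁻¹)
  rw [show xi Y j = _ from funext (xi_eq Y j), sigma_sq hn]
  have e : (2 * dyadic j)⁻¹ / n = (2 * dyadic j)⁻¹ ^ 2 *
      ((2 * dyadic j - dyadic j) / n + (-dyadic j - -(2 * dyadic j)) / n) := by
    field_simp
    ring
  rw [e]
  exact h

theorem hasLaw_deltaR (hn : 0 < n) (hf : MonotoneOn f (Set.Icc (-(1 / 2) : ℝ) (1 / 2)))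
    (hY : IsWhiteNoiseObservation f n Y P) (hj : 2 ≤ j) :
    HasLaw (deltaR Y j) (gaussianReal (driftR f j) (Real.toNNReal ((√2 * sigma n j) ^ 2))) P := by
  have h0 := dyadic_pos j
  have h1 := dyadic_le hj
  have h := hasLaw_mul
    (hasLaw_increment hn hf hY (a := 0) (b := dyadic j) (by linarith) (by linarith)
      (by linarith)) (div_nonneg (by linarith) hn.le) ((dyadic j)⁻¹)
  rw [show deltaR Y j = _ from funext (deltaR_eq Y j), mul_pow, sigma_sq hn,
    Real.sq_sqrt (by norm_num)]
  have e : 2 * ((2 * dyadic j)⁻¹ / n) = (dyadic j)⁻¹ ^ 2 * ((dyadic j - 0) / n) := by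
    field_simp
    ring
  rw [e]
  exact h

theorem hasLaw_deltaL (hn : 0 < n) (hf : MonotoneOn f (Set.Icc (-(1 / 2) : ℝ) (1 / 2)))
    (hY : IsWhiteNoiseObservation f n Y P) (hj : 2 ≤ j) :
    HasLaw (deltaL Y j) (gaussianReal (driftL f j) (Real.toNNReal ((√2 * sigma n j) ^ 2))) P := by
  have h0 := dyadic_pos j
  have h1 := dyadic_le hj
  have h := hasLaw_mul
    (hasLaw_increment hn hf hY (a := -dyadic j) (b := 0) (by linarith) (by linarith)
      (by linarith)) (div_nonneg (by linarith) hn.le) ((dyadic j)⁻¹)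
  rw [show deltaL Y j = _ from funext (deltaL_eq Y j), mul_pow, sigma_sq hn,
    Real.sq_sqrt (by norm_num)]
  have e : 2 * ((2 * dyadic j)⁻¹ / n) = (dyadic j)⁻¹ ^ 2 * ((0 - -dyadic j) / n) := by
    field_simp
    ring
  rw [e]
  exact h

theorem hasLaw_deltaR_sub_deltaL (hn : 0 < n)
    (hf : MonotoneOn f (Set.Icc (-(1 / 2) : ℝ) (1 / 2)))
    (hY : IsWhiteNoiseObservation f n Y P) (hj : 2 ≤ j) :
    HasLaw (fun ω => deltaR Y j ω - deltaL Y j ω)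
      (gaussianReal (driftR f j - driftL f j) (Real.toNNReal (4 * sigma n j ^ 2))) P := by
  have h0 := dyadic_pos j
  have h1 := dyadic_le hj
  have h := hasLaw_mul_sub
    (hasLaw_increment hn hf hY (a := 0) (b := dyadic j) (by linarith) (by linarith)
      (by linarith))
    (hasLaw_increment hn hf hY (a := -dyadic j) (b := 0) (by linarith)
      (by linarith) (by linarith))
    (indepFun_increment hf hY (by linarith) (by linarith) (by linarith) (by linarith)
      (by linarith)) (div_nonneg (by linarith) hn.le) (div_nonneg (by linarith) hn.le)
    ((dyadic j)⁻¹)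
  simp_rw [deltaR_eq, deltaL_eq]
  rw [sigma_sq hn]
  have e : 4 * ((2 * dyadic j)⁻¹ / n) =
      (dyadic j)⁻¹ ^ 2 * ((dyadic j - 0) / n + (0 - -dyadic j) / n) := by
    field_simp
    ring
  rw [e]
  exact h

/-- The two intervals on which the increments making up `xi` live. -/
noncomputable def xiInterval (i : ℕ) (b : Bool) : ℝ × ℝ :=
  if b then (dyadic i, 2 * dyadic i) else (-(2 * dyadic i), -dyadic i)

theorem xiInterval_mem {i : ℕ} (hi : 2 ≤ i) (b : Bool) : -(1 / 2) ≤ (xiInterval i b).1 ∧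
    (xiInterval i b).1 ≤ (xiInterval i b).2 ∧ (xiInterval i b).2 ≤ 1 / 2 := by
  have h0 := dyadic_pos i
  have h1 := dyadic_le hi
  cases b <;> simp only [xiInterval, if_true, Bool.false_eq_true, if_false] <;>
    exact ⟨by linarith, by linarith, by linarith⟩

/-- Intervals of distinct scales meet at most at an endpoint, since 2·2⁻ʲ ≤ 2⁻ⁱ for i < j. -/
theorem indepFun_xi (hf : MonotoneOn f (Set.Icc (-(1 / 2) : ℝ) (1 / 2)))
    (hY : IsWhiteNoiseObservation f n Y P) (hj : 2 ≤ j) :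
    IndepFun (fun ω (i : Set.Ico 2 j) => xi Y i ω) (xi Y j) P := by
  have h := indepFun_increments hf hY (fun s : Set.Ico 2 j × Bool => xiInterval s.1 s.2)
    (fun b : Bool => xiInterval j b) (fun s => xiInterval_mem s.1.2.1 _)
    (fun b => xiInterval_mem hj b) (by
      rintro ⟨⟨i, hi⟩, b⟩ b'
      have h0 := dyadic_pos i
      have h1 := dyadic_pos j
      have h2 := two_mul_dyadic_le hi.2
      cases b <;> cases b' <;> simp only [xiInterval, if_true, Bool.false_eq_true, if_false]
      · left; linarith
      · left; linarith
      · right; linarith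
      · right; linarith)
  have h' := h.comp
    (φ := fun x (i : Set.Ico 2 j) => (2 * dyadic i)⁻¹ * x (i, true)
      - (2 * dyadic i)⁻¹ * x (i, false))
    (ψ := fun x => (2 * dyadic j)⁻¹ * x true - (2 * dyadic j)⁻¹ * x false)
    (by fun_prop) (by fun_prop)
  convert h' using 1
  · funext ω i
    rw [xi_eq]
    rfl
  · funext ω
    rw [xi_eq]
    rfl

/-- The index set includes j itself, because being first accepted at j also depends on ξ_j. -/
theorem indepFun_xi_delta (hf : MonotoneOn f (Set.Icc (-(1 / 2) : ℝ) (1 / 2)))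
    (hY : IsWhiteNoiseObservation f n Y P) (hj : 2 ≤ j) :
    IndepFun (fun ω (i : Set.Icc 2 j) => xi Y i ω) (fun ω => (deltaL Y j ω, deltaR Y j ω)) P := by
  have h0 := dyadic_pos j
  have h1 := dyadic_le hj
  have h := indepFun_increments hf hY (fun s : Set.Icc 2 j × Bool => xiInterval s.1 s.2)
    (fun b : Bool => if b then (0, dyadic j) else (-dyadic j, 0))
    (fun s => xiInterval_mem s.1.2.1 _)
    (fun b => by
      cases b <;> simp only [if_true, Bool.false_eq_true, if_false] <;>
        exact ⟨by linarith, by linarith, by linarith⟩) (by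
      rintro ⟨⟨i, hi⟩, b⟩ b'
      have h0 := dyadic_pos i
      have h2 := dyadic_anti hi.2
      cases b <;> cases b' <;> simp only [xiInterval, if_true, Bool.false_eq_true, if_false]
      · left; linarith
      · left; linarith
      · right; linarith
      · right; linarith)
  have h' := h.comp
    (φ := fun x (i : Set.Icc 2 j) => (2 * dyadic i)⁻¹ * x (i, true)
      - (2 * dyadic i)⁻¹ * x (i, false))
    (ψ := fun x => ((dyadic j)⁻¹ * x false, (dyadic j)⁻¹ * x true))
    (by fun_prop) (by fun_prop)
  convert h' using 1
  · funext ω i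
    rw [xi_eq]
    rfl
  · funext ω
    rw [deltaL_eq, deltaR_eq]
    rfl

end Statistics

/-! ### Deterministic bounds for the expected length -/

theorem sqrt_two_bounds : 1.4142 < √2 ∧ √2 < 1.4143 :=
  ⟨Real.lt_sqrt_of_sq_lt (by norm_num), (Real.sqrt_lt' (by norm_num)).2 (by norm_num)⟩

/-- Backward summation over the scales where a scale is rejected with probability at most
`0.35`. -/
theorem sum_geometric_le {σ p S q : ℕ → ℝ} {A B : ℝ} {m : ℕ} (hA : 0 ≤ A) (hB : 0 ≤ B)
    (hσ0 : ∀ j, 0 < σ j) (hσ : ∀ j, σ (j + 1) = √2 * σ j)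
    (hS0 : ∀ j, 0 ≤ S j) (hp : ∀ j, m ≤ j → p j = S j * (1 - q j))
    (hS : ∀ j, m ≤ j → S (j + 1) = S j * q j) (hq0 : ∀ j, m ≤ j → 0 ≤ q j)
    (hq : ∀ j, m ≤ j → q j ≤ 0.35) (k j : ℕ) (hj : m ≤ j) :
    ∑ i ∈ Finset.Ico j (j + k), p i * (A + B * σ i) ≤ S j * (A + 1.29 * B * σ j) := by
  induction k generalizing j with
  | zero =>
    have := hσ0 j
    have := hS0 j
    simp only [add_zero, Finset.Ico_self, Finset.sum_empty]
    positivity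
  | succ k ih =>
    rw [Finset.sum_eq_sum_Ico_succ_bot (by omega), show j + (k + 1) = j + 1 + k by ring]
    refine (add_le_add le_rfl (ih (j + 1) (by omega))).trans ?_
    rw [hp j hj, hS j hj, hσ]
    obtain ⟨_, h2⟩ := sqrt_two_bounds
    have hs : 0 ≤ B * σ j := mul_nonneg hB (hσ0 j).le
    have hq0 := hq0 j hj
    have hq := hq j hj
    -- The left side increases in q, and at q = 0.35 the balancing constant is 0.65/(1 - 0.35√2) ≈
    -- 1.287.
    have h3 : 1 - q j + q j * (1.29 * √2) ≤ 1.29 := by nlinarith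
    have h4 : (1 - q j) * (A + B * σ j) + q j * (A + 1.29 * B * (√2 * σ j))
        ≤ A + 1.29 * B * σ j := by nlinarith [mul_le_mul_of_nonneg_left h3 hs]
    nlinarith [mul_le_mul_of_nonneg_left h4 (hS0 j)]

/-- The squares double from scale to scale, so the sum telescopes to σ_m² - σ_2². -/
theorem sum_sq_le {σ : ℕ → ℝ} (hσ : ∀ j, σ (j + 1) = √2 * σ j) (m : ℕ) (hm : 2 ≤ m) :
    ∑ j ∈ Finset.Ico 2 m, σ j ^ 2 ≤ σ m ^ 2 := by
  induction m, hm using Nat.le_induction with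
  | base => simp; positivity
  | succ m hm ih =>
    rw [Finset.sum_Ico_succ_top hm, hσ, mul_pow, Real.sq_sqrt (by norm_num)]
    linarith

/-- The slack 0.63z + 0.21K exceeds 1.2z and absorbs the reciprocals because z is bounded below. -/
theorem early_constant_le {z K : ℝ} (hz : 0.841 ≤ z) (hK1 : 2.828 * z ≤ K) :
    3 * z + (K + 1 / K) + 1 / (3 * z) ≤ 1.21 * (3 * z + K) := by
  have hz0 : 0 < z := by linarith
  have h1 : 1 / K ≤ 1 / (2.828 * z) := one_div_le_one_div_of_le (by positivity) hK1
  have h2 : 1 / (2.828 * z) + 1 / (3 * z) ≤ 1.2 * z := by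
    rw [div_add_div _ _ (by positivity) (by positivity), div_le_iff₀ (by positivity)]
    nlinarith [mul_self_nonneg (z - 0.841), mul_pos hz0 hz0, mul_pos hz0 (mul_pos hz0 hz0)]
  linarith

/-- Here K enters with the larger factor 1.29; the upper bound on K keeps the slack 1.63z - 0.08K
above 1.28z. -/
theorem late_constant_le {z K : ℝ} (hz : 0.841 ≤ z) (hK1 : 2.828 * z ≤ K) (hK2 : K ≤ 4.32 * z) :
    2 * z + 1.29 * (K + 1 / K) + 1 / (3 * z) ≤ 1.21 * (3 * z + K) := by
  have hz0 : 0 < z := by linarith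
  have h1 : 1 / K ≤ 1 / (2.828 * z) := one_div_le_one_div_of_le (by positivity) hK1
  have h2 : 1.29 * (1 / (2.828 * z)) + 1 / (3 * z) ≤ 1.28 * z := by
    rw [mul_one_div, div_add_div _ _ (by positivity) (by positivity), div_le_iff₀ (by positivity)]
    nlinarith [mul_self_nonneg (z - 0.841), mul_pos hz0 hz0, mul_pos hz0 (mul_pos hz0 hz0)]
  linarith

/-- The probability-free core. `q` is the rejection probability, `S` the probability of reaching a
scale, `p` that of stopping there, `D` the mean gap, `E` the mean length and `m` the target scale.
-/
theorem sum_length_le {z K : ℝ} (hz : 0.841 ≤ z) (hK1 : 2.828 * z ≤ K) (hK2 : K ≤ 4.32 * z)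
    {σ D p S q E : ℕ → ℝ} {m : ℕ} (hm : 2 ≤ m)
    (hσ0 : ∀ j, 0 < σ j) (hσ : ∀ j, σ (j + 1) = √2 * σ j) (hS2 : S 2 = 1)
    (hS0 : ∀ j, 0 ≤ S j) (hp : ∀ j, 2 ≤ j → p j = S j * (1 - q j))
    (hS : ∀ j, 2 ≤ j → S (j + 1) = S j * q j) (hq0 : ∀ j, 2 ≤ j → 0 ≤ q j)
    (hq1 : ∀ j, 2 ≤ j → q j ≤ 1) (hqm : ∀ j, m ≤ j → q j ≤ 0.35)
    (hE0 : ∀ j, 2 ≤ j → 0 ≤ E j) (hE : ∀ j, 2 ≤ j → E j ≤ D j + (K + 1 / K) * σ j)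
    (hD : ∀ j, 2 ≤ j → m ≤ j + 1 → D j ≤ 2 * z * σ m)
    (hearly : ∀ j, 2 ≤ j → j + 2 ≤ m → p j * (D j - 3 * z * σ m) ≤ σ j ^ 2 / (1.5 * z * σ m))
    (N : ℕ) :
    ∑ j ∈ Finset.Ico 2 N, p j * E j ≤ 1.21 * (3 * z + K) * σ m := by
  have hz0 : 0 < z := by linarith
  have hK0 : 0 < K := by nlinarith
  set B : ℝ := K + 1 / K with hBdef
  have hB : 0 ≤ B := by positivity
  have hmono : Monotone σ := monotone_nat_of_le_succ fun j => by
    rw [hσ]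
    exact le_mul_of_one_le_left (hσ0 j).le (Real.one_le_sqrt.2 (by norm_num))
  have hp0 : ∀ j, 2 ≤ j → 0 ≤ p j := fun j hj => by
    rw [hp j hj]
    exact mul_nonneg (hS0 j) (by linarith [hq1 j hj])
  have hσm := hσ0 m
  -- enlarge the range
  have hN : ∑ j ∈ Finset.Ico 2 N, p j * E j ≤ ∑ j ∈ Finset.Ico 2 (m + N), p j * E j := by
    refine Finset.sum_le_sum_of_subset_of_nonneg
      (Finset.Ico_subset_Ico le_rfl (by omega)) fun j hj _ => ?_
    have := (Finset.mem_Ico.1 hj).1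
    exact mul_nonneg (hp0 j this) (hE0 j this)
  refine hN.trans ?_
  rw [← Finset.sum_Ico_consecutive _ hm (Nat.le_add_right m N)]
  -- late scales
  have hlate : ∑ j ∈ Finset.Ico m (m + N), p j * E j
      ≤ S m * (2 * z * σ m + 1.29 * B * σ m) := by
    refine le_trans (Finset.sum_le_sum fun j hj => ?_)
      (sum_geometric_le (A := 2 * z * σ m) (by positivity) hB hσ0 hσ hS0
        (fun j hj => hp j (hm.trans hj)) (fun j hj => hS j (hm.trans hj))
        (fun j hj => hq0 j (hm.trans hj)) hqm N m le_rfl)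
    have hj1 := (Finset.mem_Ico.1 hj).1
    refine mul_le_mul_of_nonneg_left ?_ (hp0 j (hm.trans hj1))
    linarith [hE j (hm.trans hj1), hD j (hm.trans hj1) (by omega)]
  -- early scales
  have htel : ∀ M, 2 ≤ M → ∑ j ∈ Finset.Ico 2 M, p j = 1 - S M := by
    intro M hM
    induction M, hM using Nat.le_induction with
    | base => simp [hS2]
    | succ M hM ih =>
      rw [Finset.sum_Ico_succ_top hM, ih, hp M hM, hS M hM]
      ring
  have hex : ∑ j ∈ Finset.Ico 2 m, p j * (D j - 3 * z * σ m) ≤ 1 / (3 * z) * σ m := by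
    rcases hm.eq_or_lt with rfl | hlt
    · simp only [Finset.Ico_self, Finset.sum_empty]
      positivity
    · obtain ⟨M, rfl⟩ : ∃ M, m = M + 1 := ⟨m - 1, by omega⟩
      have hM : 2 ≤ M := by omega
      rw [Finset.sum_Ico_succ_top hM]
      -- The scale just below the target already satisfies the late bound on `D`, so it has no
      -- excess.
      have h1 : p M * (D M - 3 * z * σ (M + 1)) ≤ 0 := by
        refine mul_nonpos_of_nonneg_of_nonpos (hp0 M hM) ?_
        have := hD M hM le_rfl
        have : 0 < z * σ (M + 1) := by positivity
        linarith
      have h2 : ∑ j ∈ Finset.Ico 2 M, p j * (D j - 3 * z * σ (M + 1))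
          ≤ ∑ j ∈ Finset.Ico 2 M, σ j ^ 2 / (1.5 * z * σ (M + 1)) :=
        Finset.sum_le_sum fun j hj =>
          hearly j (Finset.mem_Ico.1 hj).1 (by have := (Finset.mem_Ico.1 hj).2; omega)
      rw [← Finset.sum_div] at h2
      -- The sum stops before M, hence is at most σ_M², which is half of σ_{M+1}².
      have h3 : (∑ j ∈ Finset.Ico 2 M, σ j ^ 2) / (1.5 * z * σ (M + 1))
          ≤ (σ (M + 1) ^ 2 / 2) / (1.5 * z * σ (M + 1)) := by
        gcongr
        rw [hσ, mul_pow, Real.sq_sqrt (by norm_num)]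
        linarith [sum_sq_le hσ M hM]
      have h4 : (σ (M + 1) ^ 2 / 2) / (1.5 * z * σ (M + 1)) = 1 / (3 * z) * σ (M + 1) := by
        field_simp
        norm_num
      linarith
  have hearly' : ∑ j ∈ Finset.Ico 2 m, p j * E j
      ≤ (1 - S m) * (3 * z * σ m + B * σ m) + 1 / (3 * z) * σ m := by
    have h1 : ∑ j ∈ Finset.Ico 2 m, p j * E j ≤ ∑ j ∈ Finset.Ico 2 m,
        (p j * (D j - 3 * z * σ m) + p j * (3 * z * σ m + B * σ m)) := by
      refine Finset.sum_le_sum fun j hj => ?_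
      obtain ⟨hj1, hj2⟩ := Finset.mem_Ico.1 hj
      rw [← mul_add]
      refine mul_le_mul_of_nonneg_left ?_ (hp0 j hj1)
      have : B * σ j ≤ B * σ m := mul_le_mul_of_nonneg_left (hmono hj2.le) hB
      linarith [hE j hj1]
    rw [Finset.sum_add_distrib, ← Finset.sum_mul, htel m hm] at h1
    linarith
  have hSm1 : S m ≤ 1 := by
    have : 0 ≤ ∑ j ∈ Finset.Ico 2 m, p j :=
      Finset.sum_nonneg fun j hj => hp0 j (Finset.mem_Ico.1 hj).1
    rw [htel m hm] at this
    linarith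
  have c1 := early_constant_le hz hK1
  have c2 := late_constant_le hz hK1 hK2
  rw [← hBdef] at c1 c2
  -- A convex combination of the early and late constants, weighted by the probability of stopping
  -- before m and of reaching m.
  have hfin : (1 - S m) * (3 * z + B + 1 / (3 * z)) + S m * (2 * z + 1.29 * B + 1 / (3 * z))
      ≤ 1.21 * (3 * z + K) := by
    nlinarith [mul_le_mul_of_nonneg_left c1 (by linarith : 0 ≤ 1 - S m),
      mul_le_mul_of_nonneg_left c2 (hS0 m)]
  have := mul_le_mul_of_nonneg_right hfin hσm.le
  linarith

/-- The positive part has mean at most `μ + v / (4 μ)` for a variable of mean `μ` and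
variance `v`. -/
theorem integral_max_zero_le {Ω : Type*} [MeasurableSpace Ω] {P : Measure Ω}
    [IsProbabilityMeasure P] {X : Ω → ℝ} {μ v : ℝ} (hX : MemLp X 2 P) (hμ : 0 < μ)
    (hm : ∫ ω, X ω ∂P = μ) (hv : ∫ ω, (X ω - μ) ^ 2 ∂P = v) :
    ∫ ω, max (X ω) 0 ∂P ≤ μ + v / (4 * μ) := by
  have hXi : Integrable X P := hX.integrable one_le_two
  have hsq : Integrable (fun ω => (X ω - μ) ^ 2) P := (hX.sub (memLp_const μ)).integrable_sq
  have h1 : ∫ ω, max (X ω) 0 ∂P ≤ ∫ ω, ((X ω - μ) ^ 2 / (4 * μ) + X ω) ∂P := by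
    refine integral_mono (hXi.sup (integrable_const 0)) ((hsq.div_const _).add hXi) fun ω => ?_
    -- The parabola (X + μ)²/(4μ) is nonnegative and touches the identity at X = μ, so it dominates
    -- the positive part.
    have e : (X ω - μ) ^ 2 / (4 * μ) + X ω = (X ω + μ) ^ 2 / (4 * μ) := by
      field_simp
      ring
    refine max_le ?_ ?_
    · have : 0 ≤ (X ω - μ) ^ 2 / (4 * μ) := by positivity
      linarith
    · change 0 ≤ (X ω - μ) ^ 2 / (4 * μ) + X ω
      rw [e]
      positivity
  rw [integral_add (hsq.div_const _) hXi, integral_div, hm, hv] at h1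
  linarith

/-! ### The selected scale -/

/-- The event that scale `j` is accepted. -/
def acceptAt {Ω : Type*} (n α : ℝ) (Y : ℝ → Ω → ℝ) (j : ℕ) : Set Ω :=
  {ω | xi Y j ω ≤ 3 / 2 * zQuantile α * sigma n j}

/-- The event that all the scales below `j` are rejected. -/
def rejectBefore {Ω : Type*} (n α : ℝ) (Y : ℝ → Ω → ℝ) (j : ℕ) : Set Ω :=
  {ω | ∀ i, 2 ≤ i → i < j → 3 / 2 * zQuantile α * sigma n i < xi Y i ω}

/-- The event that `j` is the least accepted scale. -/
def firstAccept {Ω : Type*} (n α : ℝ) (Y : ℝ → Ω → ℝ) (j : ℕ) : Set Ω :=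
  rejectBefore n α Y j ∩ acceptAt n α Y j

section Sets

variable {Ω : Type*} {n α : ℝ} {Y : ℝ → Ω → ℝ}

theorem rejectBefore_two : rejectBefore n α Y 2 = Set.univ := by
  ext ω
  simp only [rejectBefore, Set.mem_ofPred_eq, Set.mem_univ, iff_true]
  intro i h1 h2
  omega

theorem rejectBefore_succ {j : ℕ} (hj : 2 ≤ j) :
    rejectBefore n α Y (j + 1) = rejectBefore n α Y j ∩ (acceptAt n α Y j)ᶜ := by
  ext ω
  simp only [rejectBefore, acceptAt, Set.mem_ofPred_eq, Set.mem_inter_iff, Set.mem_compl_iff,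
    not_le]
  constructor
  · intro h
    exact ⟨fun i h1 h2 => h i h1 (by omega), h j hj (by omega)⟩
  · rintro ⟨h, h'⟩ i h1 h2
    rcases (Nat.lt_succ_iff_lt_or_eq.1 h2) with h3 | rfl
    · exact h i h1 h3
    · exact h'

theorem jHat_eq {j : ℕ} (hj : 2 ≤ j) {ω : Ω} (h : ω ∈ firstAccept n α Y j) :
    jHat n α Y ω = j := by
  refine le_antisymm (Nat.sInf_le ⟨hj, h.2⟩) (le_csInf ⟨j, hj, h.2⟩ ?_)
  rintro i ⟨hi1, hi2⟩
  by_contra! hlt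
  exact absurd hi2 (not_le.2 (h.1 i hi1 hlt))

theorem iUnion_firstAccept :
    ⋃ k : ℕ, firstAccept n α Y (k + 2) = {ω | (acceptedScales n α Y ω).Nonempty} := by
  ext ω
  simp only [Set.mem_iUnion, Set.mem_ofPred_eq]
  constructor
  · rintro ⟨k, hk⟩
    exact ⟨k + 2, by omega, hk.2⟩
  · intro h
    have hmem := Nat.sInf_mem h
    obtain ⟨h1, h2⟩ := hmem
    refine ⟨sInf (acceptedScales n α Y ω) - 2, ?_⟩
    rw [Nat.sub_add_cancel h1]
    refine ⟨fun i hi1 hi2 => ?_, h2⟩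
    have := Nat.notMem_of_lt_sInf hi2
    by_contra! h3
    exact this ⟨hi1, h3⟩

theorem disjoint_firstAccept :
    Pairwise (Function.onFun Disjoint fun k : ℕ => firstAccept n α Y (k + 2)) := by
  intro i k hik
  refine Set.disjoint_left.2 fun ω h1 h2 => hik ?_
  have e1 := jHat_eq (by omega) h1
  have e2 := jHat_eq (by omega) h2
  omega

theorem firstAccept_eq_preimage {j : ℕ} (hj : 2 ≤ j) :
    firstAccept n α Y j = (fun ω (i : Set.Icc 2 j) => xi Y i ω) ⁻¹'
      {x | (∀ i : Set.Icc 2 j, (i : ℕ) < j → 3 / 2 * zQuantile α * sigma n i < x i) ∧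
        x ⟨j, hj, le_rfl⟩ ≤ 3 / 2 * zQuantile α * sigma n j} := by
  ext ω
  simp only [firstAccept, rejectBefore, acceptAt, Set.mem_inter_iff, Set.mem_ofPred_eq,
    Set.mem_preimage, Subtype.forall]
  constructor
  · rintro ⟨h1, h2⟩
    exact ⟨fun i hi hij => h1 i hi.1 hij, h2⟩
  · rintro ⟨h1, h2⟩
    exact ⟨fun i hi hij => h1 i ⟨hi, hij.le⟩ hij, h2⟩

theorem measurableSet_firstAccept_pattern (n α : ℝ) {j : ℕ} (hj : 2 ≤ j) :
    MeasurableSet {x : Set.Icc 2 j → ℝ |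
      (∀ i : Set.Icc 2 j, (i : ℕ) < j → 3 / 2 * zQuantile α * sigma n i < x i) ∧
        x ⟨j, hj, le_rfl⟩ ≤ 3 / 2 * zQuantile α * sigma n j} := by
  have e : {x : Set.Icc 2 j → ℝ |
      ∀ i : Set.Icc 2 j, (i : ℕ) < j → 3 / 2 * zQuantile α * sigma n i < x i}
      = ⋂ i : Set.Icc 2 j, ⋂ _ : (i : ℕ) < j, {x | 3 / 2 * zQuantile α * sigma n i < x i} := by
    ext x
    simp
  have h : MeasurableSet {x : Set.Icc 2 j → ℝ |
      ∀ i : Set.Icc 2 j, (i : ℕ) < j → 3 / 2 * zQuantile α * sigma n i < x i} := by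
    rw [e]
    exact MeasurableSet.iInter fun i => MeasurableSet.iInter fun _ =>
      measurableSet_lt measurable_const (measurable_pi_apply _)
  exact h.inter (measurableSet_le (measurable_pi_apply _) measurable_const)

theorem rejectBefore_eq_preimage (j : ℕ) :
    rejectBefore n α Y j = (fun ω (i : Set.Ico 2 j) => xi Y i ω) ⁻¹'
      Set.univ.pi fun i => Set.Ioi (3 / 2 * zQuantile α * sigma n i) := by
  ext ω
  simp only [rejectBefore, Set.mem_ofPred_eq, Set.mem_preimage, Set.mem_univ_pi, Subtype.forall,
    Set.mem_Ioi]
  exact ⟨fun h i hi => h i hi.1 hi.2, fun h i h1 h2 => h i ⟨h1, h2⟩⟩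

theorem ciLength_eq (j : ℕ) (ω : Ω) : ciLength n α Y j ω =
    max (deltaR Y j ω - deltaL Y j ω + 2 * √2 * zQuantile (α / 2) * sigma n j) 0 := by
  rw [ciLength, ciRight, ciLeft]
  congr 1
  ring

theorem ciLength_nonneg (j : ℕ) (ω : Ω) : 0 ≤ ciLength n α Y j ω := le_max_right _ _

end Sets

/-! ### Probabilities of acceptance, rejection and selection -/

section Probabilities

variable {Ω : Type*} [MeasurableSpace Ω] {P : Measure Ω} {f : ℝ → ℝ}
  {n α : ℝ} {Y : ℝ → Ω → ℝ} {j : ℕ}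

theorem real_rejectBefore_inter (hf : MonotoneOn f (Set.Icc (-(1 / 2) : ℝ) (1 / 2)))
    (hY : IsWhiteNoiseObservation f n Y P) (hj : 2 ≤ j) {A : Set ℝ} (hA : MeasurableSet A) :
    P.real (rejectBefore n α Y j ∩ xi Y j ⁻¹' A)
      = P.real (rejectBefore n α Y j) * P.real (xi Y j ⁻¹' A) := by
  rw [rejectBefore_eq_preimage, measureReal_def,
    (indepFun_xi hf hY hj).measure_inter_preimage_eq_mul _ _
      (MeasurableSet.univ_pi fun _ => measurableSet_Ioi) hA, ENNReal.toReal_mul]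
  rfl

theorem real_rejectBefore_succ (hf : MonotoneOn f (Set.Icc (-(1 / 2) : ℝ) (1 / 2)))
    (hY : IsWhiteNoiseObservation f n Y P) (hj : 2 ≤ j) :
    P.real (rejectBefore n α Y (j + 1))
      = P.real (rejectBefore n α Y j) * P.real (acceptAt n α Y j)ᶜ := by
  rw [rejectBefore_succ hj]
  exact real_rejectBefore_inter hf hY hj
    (A := (Set.Iic (3 / 2 * zQuantile α * sigma n j))ᶜ) measurableSet_Iic.compl

theorem nullMeasurableSet_acceptAt (hn : 0 < n)
    (hf : MonotoneOn f (Set.Icc (-(1 / 2) : ℝ) (1 / 2)))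
    (hY : IsWhiteNoiseObservation f n Y P) (hj : 2 ≤ j) :
    NullMeasurableSet (acceptAt n α Y j) P :=
  (hasLaw_xi hn hf hY hj).aemeasurable.nullMeasurable measurableSet_Iic

theorem nullMeasurableSet_firstAccept (hn : 0 < n)
    (hf : MonotoneOn f (Set.Icc (-(1 / 2) : ℝ) (1 / 2)))
    (hY : IsWhiteNoiseObservation f n Y P) (hj : 2 ≤ j) :
    NullMeasurableSet (firstAccept n α Y j) P := by
  rw [firstAccept_eq_preimage hj]
  exact (aemeasurable_pi_lambda _ fun i =>
    (hasLaw_xi hn hf hY i.2.1).aemeasurable).nullMeasurable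
      (measurableSet_firstAccept_pattern n α hj)

theorem integral_xi (hn : 0 < n) (hf : MonotoneOn f (Set.Icc (-(1 / 2) : ℝ) (1 / 2)))
    (hY : IsWhiteNoiseObservation f n Y P) (hj : 2 ≤ j) :
    ∫ ω, xi Y j ω ∂P = driftXi f j :=
  integral_of_hasLaw (hasLaw_xi hn hf hY hj)

/-- The means of ξ_j are nonincreasing in j while σ_j tends to infinity. -/
theorem targetScales_nonempty (hn : 0 < n) (h0 : 0 < α) (hα : α ≤ 0.2)
    (hf : MonotoneOn f (Set.Icc (-(1 / 2) : ℝ) (1 / 2)))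
    (hY : IsWhiteNoiseObservation f n Y P) : (targetScales n α Y P).Nonempty := by
  have hz : 0 < zQuantile α := by linarith [zQuantile_ge h0 hα]
  obtain ⟨j, hj1, hj2⟩ := (((tendsto_sigma hn).const_mul_atTop hz).eventually_ge_atTop
    (driftXi f 2)).and (Filter.eventually_ge_atTop 2) |>.exists
  refine ⟨j, hj2, ?_⟩
  rw [integral_xi hn hf hY hj2]
  exact (driftXi_anti hf le_rfl hj2).trans hj1

theorem jStar_spec (hn : 0 < n) (h0 : 0 < α) (hα : α ≤ 0.2)
    (hf : MonotoneOn f (Set.Icc (-(1 / 2) : ℝ) (1 / 2)))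
    (hY : IsWhiteNoiseObservation f n Y P) :
    2 ≤ jStar n α Y P ∧ ∀ j, jStar n α Y P ≤ j →
      driftXi f j ≤ zQuantile α * sigma n (jStar n α Y P) := by
  have h := Nat.sInf_mem (targetScales_nonempty hn h0 hα hf hY)
  obtain ⟨h1, h2⟩ : 2 ≤ jStar n α Y P ∧
    ∫ ω, xi Y (jStar n α Y P) ω ∂P ≤ zQuantile α * sigma n (jStar n α Y P) := h
  refine ⟨h1, fun j hj => ?_⟩
  rw [integral_xi hn hf hY h1] at h2
  exact (driftXi_anti hf h1 hj).trans h2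

variable [IsProbabilityMeasure P]

theorem real_firstAccept (hn : 0 < n) (hf : MonotoneOn f (Set.Icc (-(1 / 2) : ℝ) (1 / 2)))
    (hY : IsWhiteNoiseObservation f n Y P) (hj : 2 ≤ j) :
    P.real (firstAccept n α Y j)
      = P.real (rejectBefore n α Y j) * (1 - P.real (acceptAt n α Y j)ᶜ) := by
  rw [probReal_compl_eq_one_sub₀ (nullMeasurableSet_acceptAt hn hf hY hj), sub_sub_cancel]
  exact real_rejectBefore_inter hf hY hj
    (A := Set.Iic (3 / 2 * zQuantile α * sigma n j)) measurableSet_Iic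

/-- The threshold (3/2)zσ_j exceeds the mean by at least zσ_j/2. -/
theorem real_reject_le (hn : 0 < n) (h0 : 0 < α) (hα : α ≤ 0.2)
    (hf : MonotoneOn f (Set.Icc (-(1 / 2) : ℝ) (1 / 2)))
    (hY : IsWhiteNoiseObservation f n Y P) (hj : 2 ≤ j)
    (hd : driftXi f j ≤ zQuantile α * sigma n j) :
    P.real (acceptAt n α Y j)ᶜ ≤ 0.35 := by
  have h := real_gt_of_hasLaw (hasLaw_xi hn hf hY hj) (sigma_pos hn j) (zQuantile α / 2)
  rw [← gaussian_Ioi] at h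
  refine (measureReal_mono ?_).trans (h.le.trans (gaussian_Ioi_half_zQuantile h0 hα))
  intro ω hω
  have hω' : 3 / 2 * zQuantile α * sigma n j < xi Y j ω := not_le.1 hω
  change driftXi f j + zQuantile α / 2 * sigma n j < xi Y j ω
  linarith

theorem real_reject_le_of_jStar_le (hn : 0 < n) (h0 : 0 < α) (hα : α ≤ 0.2)
    (hf : MonotoneOn f (Set.Icc (-(1 / 2) : ℝ) (1 / 2)))
    (hY : IsWhiteNoiseObservation f n Y P) (hj : jStar n α Y P ≤ j) :
    P.real (acceptAt n α Y j)ᶜ ≤ 0.35 := by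
  obtain ⟨h2, hs⟩ := jStar_spec hn h0 hα hf hY
  have hz : 0 < zQuantile α := by linarith [zQuantile_ge h0 hα]
  refine real_reject_le hn h0 hα hf hY (h2.trans hj) ((hs j hj).trans ?_)
  exact mul_le_mul_of_nonneg_left (sigma_mono n hj) hz.le

/-- By independence, surviving k scales beyond the target has probability at most 0.35 ^ k. -/
theorem ae_acceptedScales_nonempty (hn : 0 < n) (h0 : 0 < α) (hα : α ≤ 0.2)
    (hf : MonotoneOn f (Set.Icc (-(1 / 2) : ℝ) (1 / 2)))
    (hY : IsWhiteNoiseObservation f n Y P) :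
    ∀ᵐ ω ∂P, (acceptedScales n α Y ω).Nonempty := by
  obtain ⟨h2, -⟩ := jStar_spec hn h0 hα hf hY
  have hpow : ∀ k, P.real (rejectBefore n α Y (jStar n α Y P + k)) ≤ 0.35 ^ k := by
    intro k
    induction k with
    | zero => simp
    | succ k ih =>
      rw [← add_assoc, real_rejectBefore_succ hf hY (by omega), pow_succ]
      exact mul_le_mul ih (real_reject_le_of_jStar_le hn h0 hα hf hY (by omega))
        measureReal_nonneg (by positivity)
  have hz : P.real {ω | ¬(acceptedScales n α Y ω).Nonempty} = 0 := by
    refine le_antisymm (ge_of_tendsto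
      (tendsto_pow_atTop_nhds_zero_of_lt_one (r := (0.35 : ℝ)) (by norm_num) (by norm_num))
      (Filter.Eventually.of_forall fun k => le_trans (measureReal_mono ?_) (hpow k)))
      measureReal_nonneg
    intro ω hω i hi _
    by_contra! h
    exact hω ⟨i, hi, h⟩
  rw [ae_iff]
  exact (measureReal_eq_zero_iff).1 hz

theorem iUnion_firstAccept_ae (hn : 0 < n) (h0 : 0 < α) (hα : α ≤ 0.2)
    (hf : MonotoneOn f (Set.Icc (-(1 / 2) : ℝ) (1 / 2)))
    (hY : IsWhiteNoiseObservation f n Y P) :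
    (⋃ k : ℕ, firstAccept n α Y (k + 2)) =ᵐ[P] Set.univ := by
  rw [Filter.eventuallyEq_univ, iUnion_firstAccept]
  exact ae_acceptedScales_nonempty hn h0 hα hf hY

/-! ### Coverage -/

theorem real_notMem_ci_le (hn : 0 < n) (h0 : 0 < α) (hα : α ≤ 0.2)
    (hf : MonotoneOn f (Set.Icc (-(1 / 2) : ℝ) (1 / 2)))
    (hY : IsWhiteNoiseObservation f n Y P) (hj : 2 ≤ j) :
    P.real {ω | f 0 ∉ ci n α Y j ω} ≤ α := by
  have hs : 0 < √2 * sigma n j := mul_pos (by positivity) (sigma_pos hn j)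
  have hL := real_gt_of_hasLaw (hasLaw_deltaL hn hf hY hj) hs (zQuantile (α / 2))
  have hR := real_lt_of_hasLaw (hasLaw_deltaR hn hf hY hj) hs (zQuantile (α / 2))
  have hq := le_cdf_zQuantile (α := α / 2) (by linarith) (by linarith)
  have hsub : {ω | f 0 ∉ ci n α Y j ω} ⊆
      {ω | driftL f j + zQuantile (α / 2) * (√2 * sigma n j) < deltaL Y j ω} ∪
      {ω | deltaR Y j ω < driftR f j - zQuantile (α / 2) * (√2 * sigma n j)} := by
    intro ω hω
    have h1 := le_driftR hf hj
    have h2 := driftL_le hf hj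
    by_contra hcon
    simp only [Set.mem_union, Set.mem_ofPred_eq, not_or, not_lt] at hcon
    refine hω ⟨?_, ?_⟩
    · rw [ciLeft]
      linarith [hcon.1]
    · rw [ciRight]
      linarith [hcon.2]
  refine (measureReal_mono hsub).trans ((measureReal_union_le _ _).trans ?_)
  rw [hL, hR]
  linarith

theorem measurableSet_uncovered (n α x : ℝ) (j : ℕ) :
    MeasurableSet {p : ℝ × ℝ | ¬(p.1 - zQuantile (α / 2) * √2 * sigma n j ≤ x ∧
      x ≤ p.2 + zQuantile (α / 2) * √2 * sigma n j)} :=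
  ((measurableSet_le (measurable_fst.sub_const _) measurable_const).inter
    (measurableSet_le measurable_const (measurable_snd.add_const _))).compl

theorem measure_firstAccept_inter_notMem_le (hn : 0 < n) (h0 : 0 < α) (hα : α ≤ 0.2)
    (hf : MonotoneOn f (Set.Icc (-(1 / 2) : ℝ) (1 / 2)))
    (hY : IsWhiteNoiseObservation f n Y P) (hj : 2 ≤ j) :
    P (firstAccept n α Y j ∩ {ω | f 0 ∉ ci n α Y j ω})
      ≤ P (firstAccept n α Y j) * ENNReal.ofReal α := by
  have h := (indepFun_xi_delta hf hY hj).measure_inter_preimage_eq_mul _ _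
    (measurableSet_firstAccept_pattern n α hj) (measurableSet_uncovered n α (f 0) j)
  rw [← firstAccept_eq_preimage hj] at h
  refine h.le.trans (mul_le_mul_right ?_ _)
  rw [← ofReal_measureReal]
  exact ENNReal.ofReal_le_ofReal (real_notMem_ci_le hn h0 hα hf hY hj)

theorem tsum_measure_firstAccept (hn : 0 < n) (h0 : 0 < α) (hα : α ≤ 0.2)
    (hf : MonotoneOn f (Set.Icc (-(1 / 2) : ℝ) (1 / 2)))
    (hY : IsWhiteNoiseObservation f n Y P) :
    ∑' k : ℕ, P (firstAccept n α Y (k + 2)) = 1 := by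
  rw [← measure_iUnion₀ (disjoint_firstAccept.mono fun _ _ h => h.aedisjoint)
    fun k => nullMeasurableSet_firstAccept hn hf hY (by omega),
    measure_congr (iUnion_firstAccept_ae hn h0 hα hf hY), measure_univ]

theorem compl_covered_ae_eq (hn : 0 < n) (h0 : 0 < α) (hα : α ≤ 0.2)
    (hf : MonotoneOn f (Set.Icc (-(1 / 2) : ℝ) (1 / 2)))
    (hY : IsWhiteNoiseObservation f n Y P) :
    ({ω | f 0 ∈ ciStar n α Y ω}ᶜ : Set Ω) =ᵐ[P]
      (⋃ k : ℕ, firstAccept n α Y (k + 2) ∩ {ω | f 0 ∉ ci n α Y (k + 2) ω} : Set Ω) := by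
  filter_upwards [Filter.eventuallyEq_univ.1 (iUnion_firstAccept_ae hn h0 hα hf hY)] with ω hω
  obtain ⟨k, hk⟩ := Set.mem_iUnion.1 hω
  have hj := jHat_eq (by omega) hk
  apply propext
  change f 0 ∉ ciStar n α Y ω ↔
    ω ∈ ⋃ k : ℕ, firstAccept n α Y (k + 2) ∩ {ω | f 0 ∉ ci n α Y (k + 2) ω}
  simp only [Set.mem_iUnion, Set.mem_inter_iff, Set.mem_ofPred_eq]
  rw [ciStar, hj]
  refine ⟨fun h => ⟨k, hk, h⟩, ?_⟩
  rintro ⟨i, hi, h⟩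
  have : k + 2 = i + 2 := hj.symm.trans (jHat_eq (by omega) hi)
  rwa [this]

theorem nullMeasurableSet_covered (hn : 0 < n) (h0 : 0 < α) (hα : α ≤ 0.2)
    (hf : MonotoneOn f (Set.Icc (-(1 / 2) : ℝ) (1 / 2)))
    (hY : IsWhiteNoiseObservation f n Y P) :
    NullMeasurableSet {ω | f 0 ∈ ciStar n α Y ω} P := by
  rw [← NullMeasurableSet.compl_iff]
  refine NullMeasurableSet.congr (NullMeasurableSet.iUnion fun k => ?_)
    (compl_covered_ae_eq hn h0 hα hf hY).symm
  refine (nullMeasurableSet_firstAccept hn hf hY (by omega)).inter ?_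
  exact ((hasLaw_deltaL hn hf hY (by omega)).aemeasurable.prodMk
    (hasLaw_deltaR hn hf hY (by omega)).aemeasurable).nullMeasurable
    (measurableSet_uncovered n α (f 0) (k + 2))

theorem real_covered_ge (hn : 0 < n) (h0 : 0 < α) (hα : α ≤ 0.2)
    (hf : MonotoneOn f (Set.Icc (-(1 / 2) : ℝ) (1 / 2)))
    (hY : IsWhiteNoiseObservation f n Y P) :
    1 - α ≤ P.real {ω | f 0 ∈ ciStar n α Y ω} := by
  have h : P {ω | f 0 ∈ ciStar n α Y ω}ᶜ ≤ ENNReal.ofReal α := by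
    rw [measure_congr (compl_covered_ae_eq hn h0 hα hf hY)]
    refine (measure_iUnion_le _).trans ((ENNReal.tsum_le_tsum fun k =>
      measure_firstAccept_inter_notMem_le hn h0 hα hf hY (by omega)).trans ?_)
    rw [ENNReal.tsum_mul_right, tsum_measure_firstAccept hn h0 hα hf hY, one_mul]
  have h' : P.real {ω | f 0 ∈ ciStar n α Y ω}ᶜ ≤ α := ENNReal.toReal_le_of_le_ofReal h0.le h
  rw [probReal_compl_eq_one_sub₀ (nullMeasurableSet_covered hn h0 hα hf hY)] at h'
  linarith

/-! ### Expected length -/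

theorem memLp_length (hn : 0 < n) (hf : MonotoneOn f (Set.Icc (-(1 / 2) : ℝ) (1 / 2)))
    (hY : IsWhiteNoiseObservation f n Y P) (hj : 2 ≤ j) (c : ℝ) :
    MemLp (fun ω => deltaR Y j ω - deltaL Y j ω + c) 2 P :=
  (memLp_of_hasLaw (hasLaw_deltaR_sub_deltaL hn hf hY hj)).add (memLp_const c)

theorem integrable_ciLength (hn : 0 < n) (hf : MonotoneOn f (Set.Icc (-(1 / 2) : ℝ) (1 / 2)))
    (hY : IsWhiteNoiseObservation f n Y P) (hj : 2 ≤ j) :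
    Integrable (ciLength n α Y j) P := by
  rw [show ciLength n α Y j = _ from funext (ciLength_eq j)]
  exact ((memLp_length hn hf hY hj _).integrable one_le_two).sup (integrable_const 0)

theorem integral_ciLength_le (hn : 0 < n) (h0 : 0 < α) (hα : α ≤ 0.2)
    (hf : MonotoneOn f (Set.Icc (-(1 / 2) : ℝ) (1 / 2)))
    (hY : IsWhiteNoiseObservation f n Y P) (hj : 2 ≤ j) :
    ∫ ω, ciLength n α Y j ω ∂P ≤ (driftR f j - driftL f j) +
      (2 * √2 * zQuantile (α / 2) + 1 / (2 * √2 * zQuantile (α / 2))) * sigma n j := by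
  have hw : 0 < zQuantile (α / 2) := by
    linarith [zQuantile_ge h0 hα, zQuantile_le_half h0 (by linarith : α < 1)]
  set K : ℝ := 2 * √2 * zQuantile (α / 2) with hK
  have hK0 : 0 < K := by positivity
  have hs := sigma_pos hn j
  have hD : 0 ≤ driftR f j - driftL f j := by linarith [le_driftR hf hj, driftL_le hf hj]
  have hlaw := hasLaw_deltaR_sub_deltaL hn hf hY hj
  have hKs : 0 < K * sigma n j := by positivity
  set D := driftR f j - driftL f j
  have hμ : 0 < D + K * sigma n j := by linarith
  have hv := integral_sq_of_hasLaw hlaw (by positivity)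
  have h := integral_max_zero_le (memLp_length hn hf hY hj (K * sigma n j))
    (μ := D + K * sigma n j) (v := 4 * sigma n j ^ 2) hμ (by
      rw [integral_add ((memLp_of_hasLaw hlaw).integrable one_le_two) (integrable_const _),
        integral_of_hasLaw hlaw]
      simp) (by
      rw [← hv]
      congr 1
      funext ω
      ring)
  simp_rw [ciLength_eq]
  refine h.trans ?_
  -- Dropping D ≥ 0 from the denominator leaves σ²/(Kσ).
  have h2 : 4 * sigma n j ^ 2 / (4 * (D + K * sigma n j)) ≤ 1 / K * sigma n j := by
    rw [mul_div_mul_left _ _ four_ne_zero, div_le_iff₀ hμ]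
    have : 1 / K * sigma n j * (D + K * sigma n j) = 1 / K * sigma n j * D + sigma n j ^ 2 := by
      field_simp
    rw [this]
    have : 0 ≤ 1 / K * sigma n j * D := by positivity
    linarith
  linarith

/-- Chebyshev's inequality: acceptance forces ξ_j to fall at least x below its mean. -/
theorem real_acceptAt_mul_le (hn : 0 < n) (hf : MonotoneOn f (Set.Icc (-(1 / 2) : ℝ) (1 / 2)))
    (hY : IsWhiteNoiseObservation f n Y P) (hj : 2 ≤ j) {x : ℝ} (hx : 0 < x)
    (hd : driftXi f j = 3 / 2 * zQuantile α * sigma n j + x) :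
    P.real (acceptAt n α Y j) * x ^ 2 ≤ sigma n j ^ 2 := by
  have hlaw := hasLaw_xi hn hf hY hj
  have h := meas_ge_le_variance_div_sq (memLp_of_hasLaw hlaw) hx
  rw [hlaw.variance_eq, variance_id_gaussianReal, Real.coe_toNNReal _ (by positivity),
    integral_of_hasLaw hlaw] at h
  have h' : P.real {ω | x ≤ |xi Y j ω - driftXi f j|} ≤ sigma n j ^ 2 / x ^ 2 :=
    ENNReal.toReal_le_of_le_ofReal (by positivity) h
  rw [← le_div_iff₀ (by positivity)]
  refine (measureReal_mono ?_).trans h'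
  intro ω hω
  have hω' : xi Y j ω ≤ 3 / 2 * zQuantile α * sigma n j := hω
  change x ≤ |_|
  rw [abs_sub_comm]
  exact le_trans (by linarith) (le_abs_self _)

theorem real_firstAccept_mul_le (hn : 0 < n) (h0 : 0 < α) (hα : α ≤ 0.2)
    (hf : MonotoneOn f (Set.Icc (-(1 / 2) : ℝ) (1 / 2)))
    (hY : IsWhiteNoiseObservation f n Y P) (hj : 2 ≤ j) {m : ℕ} (hm : j + 2 ≤ m) :
    P.real (firstAccept n α Y j) * (driftR f j - driftL f j - 3 * zQuantile α * sigma n m)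
      ≤ sigma n j ^ 2 / (1.5 * zQuantile α * sigma n m) := by
  have hz : 0 < zQuantile α := by linarith [zQuantile_ge h0 hα]
  have hsm := sigma_pos hn m
  have hsj := sigma_pos hn j
  have hp0 : 0 ≤ P.real (firstAccept n α Y j) := measureReal_nonneg
  have hpa : P.real (firstAccept n α Y j) ≤ P.real (acceptAt n α Y j) :=
    measureReal_mono Set.inter_subset_right
  have hσ : 2 * sigma n j ≤ sigma n m := by
    refine le_trans (le_of_eq ?_) (sigma_mono n hm)
    rw [sigma_succ, sigma_succ, ← mul_assoc, Real.mul_self_sqrt (by norm_num)]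
  have hD := (driftR_sub_driftL_le hf hj).trans (le_two_mul_driftXi hf hj)
  rcases le_or_gt (driftR f j - driftL f j) (3 * zQuantile α * sigma n m) with h | h
  · refine (mul_nonpos_of_nonneg_of_nonpos hp0 (by linarith)).trans (by positivity)
  · have hzσ : 2 * (zQuantile α * sigma n j) ≤ zQuantile α * sigma n m := by
      nlinarith [mul_le_mul_of_nonneg_left hσ hz.le]
    have hzj : 0 < zQuantile α * sigma n j := by positivity
    obtain ⟨x, hx⟩ : ∃ x, x = driftXi f j - 3 / 2 * zQuantile α * sigma n j := ⟨_, rfl⟩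
    have hx0 : 0 < x := by linarith
    have hch := real_acceptAt_mul_le (P := P) (α := α) hn hf hY hj hx0 (by linarith)
    set A := 1.5 * zQuantile α * sigma n m with hA
    have hA0 : 0 < A := by positivity
    -- Since D ≤ 2 E ξ_j and σ_j ≤ σ_m / 2, the excess is at most 2x - A; then (2x - A)A ≤ x² is (x
    -- - A)² ≥ 0, and x² cancels the Chebyshev denominator.
    have h1 : (driftR f j - driftL f j - 3 * zQuantile α * sigma n m) * A ≤ x ^ 2 := by
      have : driftR f j - driftL f j - 3 * zQuantile α * sigma n m ≤ 2 * x - A := by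
        rw [hA]
        linarith
      nlinarith [sq_nonneg (x - A)]
    rw [le_div_iff₀ hA0, mul_assoc]
    calc P.real (firstAccept n α Y j)
          * ((driftR f j - driftL f j - 3 * zQuantile α * sigma n m) * A)
        ≤ P.real (firstAccept n α Y j) * x ^ 2 := mul_le_mul_of_nonneg_left h1 hp0
      _ ≤ P.real (acceptAt n α Y j) * x ^ 2 := mul_le_mul_of_nonneg_right hpa (by positivity)
      _ ≤ _ := hch

theorem setLIntegral_firstAccept_ciLength (hn : 0 < n)
    (hf : MonotoneOn f (Set.Icc (-(1 / 2) : ℝ) (1 / 2)))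
    (hY : IsWhiteNoiseObservation f n Y P) (hj : 2 ≤ j) :
    ∫⁻ ω in firstAccept n α Y j, ENNReal.ofReal (ciLength n α Y j ω) ∂P
      = ENNReal.ofReal (P.real (firstAccept n α Y j) * ∫ ω, ciLength n α Y j ω ∂P) := by
  set s := {x : Set.Icc 2 j → ℝ |
      (∀ i : Set.Icc 2 j, (i : ℕ) < j → 3 / 2 * zQuantile α * sigma n i < x i) ∧
        x ⟨j, hj, le_rfl⟩ ≤ 3 / 2 * zQuantile α * sigma n j} with hs
  have hsm : MeasurableSet s := measurableSet_firstAccept_pattern n α hj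
  have hnull := nullMeasurableSet_firstAccept (α := α) hn hf hY hj
  have hind : IndepFun (fun ω => (firstAccept n α Y j).indicator (1 : Ω → ENNReal) ω)
      (fun ω => ENNReal.ofReal (ciLength n α Y j ω)) P := by
    have h := (indepFun_xi_delta hf hY hj).comp
      (φ := s.indicator (1 : (Set.Icc 2 j → ℝ) → ENNReal))
      (ψ := fun p : ℝ × ℝ => ENNReal.ofReal
        (max (p.2 - p.1 + 2 * √2 * zQuantile (α / 2) * sigma n j) 0))
      (measurable_one.indicator hsm) (by fun_prop)
    convert h using 1
    · rw [firstAccept_eq_preimage hj]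
      rfl
    · funext ω
      rw [ciLength_eq]
      rfl
  have hmul := lintegral_mul_eq_lintegral_mul_lintegral_of_indepFun''
    (f := (firstAccept n α Y j).indicator (1 : Ω → ENNReal)) (aemeasurable_one.indicator₀ hnull)
    (integrable_ciLength (α := α) hn hf hY hj).aemeasurable.ennreal_ofReal hind
  rw [lintegral_indicator_one₀ hnull] at hmul
  rw [← lintegral_indicator₀ hnull, ENNReal.ofReal_mul measureReal_nonneg, ofReal_measureReal,
    ofReal_integral_eq_lintegral_ofReal (integrable_ciLength hn hf hY hj)
      (Filter.Eventually.of_forall fun ω => ciLength_nonneg j ω), ← hmul]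
  congr 1
  funext ω
  by_cases hω : ω ∈ firstAccept n α Y j <;> simp [hω]

theorem aemeasurable_ciStarLength (hn : 0 < n) (h0 : 0 < α) (hα : α ≤ 0.2)
    (hf : MonotoneOn f (Set.Icc (-(1 / 2) : ℝ) (1 / 2)))
    (hY : IsWhiteNoiseObservation f n Y P) : AEMeasurable (ciStarLength n α Y) P := by
  have h : AEMeasurable (ciStarLength n α Y)
      (P.restrict (⋃ k : ℕ, firstAccept n α Y (k + 2))) := by
    rw [aemeasurable_iUnion_iff]
    intro k
    refine AEMeasurable.congr
      (integrable_ciLength (α := α) hn hf hY (j := k + 2) (by omega)).aemeasurable.restrict ?_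
    filter_upwards [ae_restrict_mem₀ (nullMeasurableSet_firstAccept hn hf hY (by omega))] with ω hω
    rw [ciStarLength, jHat_eq (by omega) hω]
  rwa [Measure.restrict_congr_set (iUnion_firstAccept_ae hn h0 hα hf hY),
    Measure.restrict_univ] at h

/-- The events of first acceptance partition Ω almost surely. With lower integrals no integrability
is needed beforehand; it follows from the final bound. -/
theorem lintegral_ciStarLength (hn : 0 < n) (h0 : 0 < α) (hα : α ≤ 0.2)
    (hf : MonotoneOn f (Set.Icc (-(1 / 2) : ℝ) (1 / 2)))
    (hY : IsWhiteNoiseObservation f n Y P) :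
    ∫⁻ ω, ENNReal.ofReal (ciStarLength n α Y ω) ∂P = ∑' k : ℕ, ENNReal.ofReal
      (P.real (firstAccept n α Y (k + 2)) * ∫ ω, ciLength n α Y (k + 2) ω ∂P) := by
  rw [← setLIntegral_univ, ← setLIntegral_congr (iUnion_firstAccept_ae hn h0 hα hf hY),
    lintegral_iUnion₀ (fun k => nullMeasurableSet_firstAccept hn hf hY (by omega))
      (disjoint_firstAccept.mono fun _ _ h => h.aedisjoint)]
  refine tsum_congr fun k => ?_
  rw [← setLIntegral_firstAccept_ciLength hn hf hY (by omega)]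
  refine lintegral_congr_ae ?_
  filter_upwards [ae_restrict_mem₀ (nullMeasurableSet_firstAccept hn hf hY (by omega))] with ω hω
  rw [ciStarLength, jHat_eq (by omega) hω]

theorem lintegral_ciStarLength_le (hn : 0 < n) (h0 : 0 < α) (hα : α ≤ 0.2)
    (hf : MonotoneOn f (Set.Icc (-(1 / 2) : ℝ) (1 / 2)))
    (hY : IsWhiteNoiseObservation f n Y P) :
    ∫⁻ ω, ENNReal.ofReal (ciStarLength n α Y ω) ∂P ≤ ENNReal.ofReal
      (1.21 * (3 * zQuantile α + 2 * √2 * zQuantile (α / 2)) * sigma n (jStar n α Y P)) := by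
  have hz := zQuantile_ge h0 hα
  have hw := zQuantile_le_half h0 (by linarith : α < 1)
  have hw' := zQuantile_half_le h0 hα
  obtain ⟨hs1, hs2⟩ := sqrt_two_bounds
  obtain ⟨hm, hstar⟩ := jStar_spec hn h0 hα hf hY
  have hlen0 : ∀ j, 0 ≤ ∫ ω, ciLength n α Y j ω ∂P := fun j =>
    integral_nonneg fun ω => ciLength_nonneg j ω
  rw [lintegral_ciStarLength hn h0 hα hf hY]
  refine ENNReal.tsum_le_of_sum_range_le fun N => ?_
  rw [← ENNReal.ofReal_sum_of_nonneg fun k _ => mul_nonneg measureReal_nonneg (hlen0 _)]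
  refine ENNReal.ofReal_le_ofReal ?_
  have h := sum_length_le (z := zQuantile α) (K := 2 * √2 * zQuantile (α / 2)) hz
    (by nlinarith) (by nlinarith) (σ := sigma n) (D := fun j => driftR f j - driftL f j)
    (p := fun j => P.real (firstAccept n α Y j)) (S := fun j => P.real (rejectBefore n α Y j))
    (q := fun j => P.real (acceptAt n α Y j)ᶜ) (E := fun j => ∫ ω, ciLength n α Y j ω ∂P)
    (m := jStar n α Y P) hm (sigma_pos hn) (sigma_succ n) (by simp [rejectBefore_two])
    (fun _ => measureReal_nonneg) (fun j hj => real_firstAccept hn hf hY hj)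
    (fun j hj => real_rejectBefore_succ hf hY hj) (fun _ _ => measureReal_nonneg)
    (fun _ _ => measureReal_le_one) (fun j hj => real_reject_le_of_jStar_le hn h0 hα hf hY hj)
    (fun j _ => hlen0 j) (fun j hj => integral_ciLength_le hn h0 hα hf hY hj)
    (fun j hj hjm => by
      have := driftR_sub_driftL_le_succ hf hj
      have := hstar (j + 1) hjm
      linarith)
    (fun j hj hjm => real_firstAccept_mul_le hn h0 hα hf hY hj hjm) (2 + N)
  rw [Finset.sum_Ico_eq_sum_range] at h
  simpa only [Nat.add_sub_cancel_left, Nat.add_sub_cancel, add_comm] using h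

theorem constant_le (h0 : 0 < α) (hα : α ≤ 0.2) :
    1.21 * (3 * zQuantile α + 2 * √2 * zQuantile (α / 2)) ≤ 8.85 * zQuantile α := by
  have hz := zQuantile_ge h0 hα
  have h := zQuantile_half_le h0 hα
  -- The cruder bound 1.4143 would overshoot: it gives about 8.8502 instead of 8.8499.
  have hs : √2 < 1.41422 := (Real.sqrt_lt' (by norm_num)).2 (by norm_num)
  have h1 : √2 * zQuantile (α / 2) ≤ 1.41422 * (1.5252 * zQuantile α) :=
    mul_le_mul hs.le h (by linarith [zQuantile_le_half h0 (by linarith : α < 1)]) (by norm_num)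
  linarith

end Probabilities

end MonotoneCI

/-! ### The main theorem -/

theorem theorem2 {Ω : Type*} [MeasurableSpace Ω] (P : MeasureTheory.Measure Ω)
    [MeasureTheory.IsProbabilityMeasure P]
    (n : ℝ) (hn : 0 < n) (α : ℝ) (hα₀ : 0 < α) (hα : α ≤ 0.2)
    (f : ℝ → ℝ) (hf : MonotoneOn f (Set.Icc (-(1 / 2) : ℝ) (1 / 2)))
    (Y : ℝ → Ω → ℝ) (hY : MonotoneCI.IsWhiteNoiseObservation f n Y P) :
    -- the selected scale and the target scale exist
    (∀ᵐ ω ∂P, (MonotoneCI.acceptedScales n α Y ω).Nonempty) ∧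
    (∀ j, 2 ≤ j → MeasureTheory.Integrable (MonotoneCI.xi Y j) P) ∧
    (MonotoneCI.targetScales n α Y P).Nonempty ∧
    -- coverage
    MeasureTheory.NullMeasurableSet {ω | f 0 ∈ MonotoneCI.ciStar n α Y ω} P ∧
    1 - α ≤ P.real {ω | f 0 ∈ MonotoneCI.ciStar n α Y ω} ∧
    -- expected length
    MeasureTheory.Integrable (MonotoneCI.ciStarLength n α Y) P ∧
    ∫ ω, MonotoneCI.ciStarLength n α Y ω ∂P ≤
      1.21 * (3 * MonotoneCI.zQuantile α + 2 * √2 * MonotoneCI.zQuantile (α / 2)) *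
        MonotoneCI.sigma n (MonotoneCI.jStar n α Y P) ∧
    1.21 * (3 * MonotoneCI.zQuantile α + 2 * √2 * MonotoneCI.zQuantile (α / 2)) *
        MonotoneCI.sigma n (MonotoneCI.jStar n α Y P) ≤
      8.85 * MonotoneCI.zQuantile α * MonotoneCI.sigma n (MonotoneCI.jStar n α Y P) := by
  have hz := MonotoneCI.zQuantile_ge hα₀ hα
  have hs := MonotoneCI.sigma_pos hn (MonotoneCI.jStar n α Y P)
  have hw := MonotoneCI.zQuantile_le_half hα₀ (by linarith : α < 1)
  have hle := MonotoneCI.lintegral_ciStarLength_le hn hα₀ hα hf hY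
  have hnonneg : ∀ᵐ ω ∂P, 0 ≤ MonotoneCI.ciStarLength n α Y ω :=
    Filter.Eventually.of_forall fun ω => MonotoneCI.ciLength_nonneg _ ω
  have hmeas := (MonotoneCI.aemeasurable_ciStarLength hn hα₀ hα hf hY).aestronglyMeasurable
  have hz0 : 0 ≤ MonotoneCI.zQuantile α := by linarith
  have hw0 : 0 ≤ MonotoneCI.zQuantile (α / 2) := by linarith
  refine ⟨MonotoneCI.ae_acceptedScales_nonempty hn hα₀ hα hf hY, fun j hj =>
      (MonotoneCI.memLp_of_hasLaw (MonotoneCI.hasLaw_xi hn hf hY hj)).integrable one_le_two,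
    MonotoneCI.targetScales_nonempty hn hα₀ hα hf hY,
    MonotoneCI.nullMeasurableSet_covered hn hα₀ hα hf hY,
    MonotoneCI.real_covered_ge hn hα₀ hα hf hY, ⟨hmeas, ?_⟩, ?_,
    mul_le_mul_of_nonneg_right (MonotoneCI.constant_le hα₀ hα) hs.le⟩
  · rw [MeasureTheory.hasFiniteIntegral_iff_ofReal hnonneg]
    exact hle.trans_lt ENNReal.ofReal_lt_top
  · rw [MeasureTheory.integral_eq_lintegral_of_nonneg_ae hnonneg hmeas]
    exact ENNReal.toReal_le_of_le_ofReal (by positivity) hle
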